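/- Let $\mathbb T=\mathbb R/\mathbb Z$, identified with $[0,1)$. For a probability measure $\mu$ on $\mathbb T$, let $F:\mathbb R\to[0,1]$ be its distribution function, $F(t)=\mu([0,t])$ for $0\le t<1$, $F(t)=0$ for $t<0$ and $F(t)=1$ for $t\ge 1$; and let $$\underline{\dim}_{\rm loc}\,\mu(x)=\liminf_{r\to 0^+}\frac{\log \mu(B_r(x))}{\log r}\qquad(x\in\mathbb T)$$ (with $\log 0=-\infty$) be its lower local dimension at $x$. **Proposition.** If $F$ is Hölder continuous on $\mathbb R$ with exponent $\alpha$, then $\underline{\dim}_{\rm loc}\,\mu(x)\ge\alpha$ for all $x\in\mathbb T$. **Corollary.** Let $k\ge 2$ and let $f:\mathbb N_0\to\mathbb Z$ be a $k$-regular sequence, that is, the $\mathbb Q$-vector space $\mathcal V_k(f)$ spanned by the sequences $(f(k^\ell n+r))_{n\ge 0}$, $\ell\ge 0$, $0\le r<k^\ell$, is finite-dimensional. Suppose that $f(0)\ge 0$ and $f(m)>0$ for all $m\ge 1$. Let $f_1,\dots,f_d$ be a basis of $\mathcal V_k(f)$, put $\mathbf f=(f_1,\dots,f_d)^T$, let $\mathbf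 B_0,\dots,\mathbf B_{k-1}$ be the $d\times d$ rational matrices with $\mathbf f(km+a)=\mathbf B_a\mathbf f(m)$ for all $m\ge 0$, and let $\mathbf B=\sum_{a=0}^{k-1}\mathbf B_a$. Let $\rho$ be the spectral radius of $\mathbf B$ and let $$\rho^*=\limsup_{n\to\infty}\max_{0\le i_1,\dots,i_n\le k-1}\|\mathbf B_{i_1}\cdots\mathbf B_{i_n}\|^{1/n}$$ be the joint spectral radius of $\{\mathbf B_0,\dots,\mathbf B_{k-1}\}$. Suppose that $\rho$ is the unique dominant eigenvalue of $\mathbf B$ (it is an eigenvalue, and every other eigenvalue has modulus less than $\rho$) and that $\rho>\rho^*$. Then the probability measures $$\mu_{f,n}=\Big(\sum_{m=k^n}^{k^{n+1}-1}f(m)\Big)^{-1}\sum_{m=0}^{k^{n+1}-k^n-1}f(k^n+m)\,\delta_{m/(k^n(k-1))}$$ converge weakly, as $n\to\infty$, to a probability measure $\mu_f$ on $\mathbb T$ without atoms, and $$\underline{\dim}_{\rm loc}\,\mu_f(x)\ \ge\ \log_k(\rho/\rho^*)\qquad\text{for all }x\in\mathbb T,$$ uniformly in $x$: for every $\varepsilon>0$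 there is $r_0>0$ such that $\log\mu_f(B_r(x))/\log r\ge\log_k(\rho/\rho^*)-\varepsilon$ for all $x\in\mathbb T$ and $0<r<r_0$. -/

import Mathlib

open Filter Topology MeasureTheory

noncomputable section

namespace RegularSeq

/-- The `k`-kernel of an integer sequence: all the sequences `n ↦ f (k ^ ℓ * n + r)` with
`0 ≤ r < k ^ ℓ`, regarded as rational sequences. -/
def kernel (k : ℕ) (f : ℕ → ℤ) : Set (ℕ → ℚ) :=
  {g | ∃ ℓ r : ℕ, r < k ^ ℓ ∧ ∀ n, g n = (f (k ^ ℓ * n + r) : ℚ)}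

/-- The rational vector space `𝒱_k(f)` generated by the `k`-kernel of `f`. -/
def kernelSpace (k : ℕ) (f : ℕ → ℤ) : Submodule ℚ (ℕ → ℚ) :=
  Submodule.span ℚ (kernel k f)

/-- `f` is `k`-regular if its `k`-kernel generates a finite-dimensional rational vector space. -/
def IsRegular (k : ℕ) (f : ℕ → ℤ) : Prop :=
  Module.Finite ℚ (kernelSpace k f)

/-- `B 0, …, B (k - 1)` are the digit matrices of the basis `b = (f_1, …, f_d)` of `𝒱_k(f)`:
`𝐟(k m + a) = B_a 𝐟(m)` for all `m ≥ 0`, where `𝐟(m) = (f_1(m), …, f_d(m))ᵀ`.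
As `b` is a basis, such matrices exist and are unique. -/
def IsDigitMatrices {k : ℕ} {f : ℕ → ℤ} {d : ℕ} (b : Module.Basis (Fin d) ℚ (kernelSpace k f))
    (B : Fin k → Matrix (Fin d) (Fin d) ℚ) : Prop :=
  ∀ (a : Fin k) (m : ℕ) (i : Fin d),
    (b i : ℕ → ℚ) (k * m + a) = ∑ j, B a i j * (b j : ℕ → ℚ) m

/-- A rational matrix regarded as a complex matrix. -/
def toComplex {d : ℕ} (M : Matrix (Fin d) (Fin d) ℚ) : Matrix (Fin d) (Fin d) ℂ :=
  M.map (algebraMap ℚ ℂ)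

/-- The spectral radius `ρ(M)` of a complex matrix, as a real number. -/
def specRadius {d : ℕ} (M : Matrix (Fin d) (Fin d) ℂ) : ℝ :=
  (spectralRadius ℂ M).toReal

/-- The spectral radius of `M` is an eigenvalue of `M`, and every other eigenvalue has strictly
smaller modulus. -/
def SpecRadiusUniqueDominant {d : ℕ} (M : Matrix (Fin d) (Fin d) ℂ) : Prop :=
  (specRadius M : ℂ) ∈ spectrum ℂ M ∧
    ∀ z ∈ spectrum ℂ M, z ≠ (specRadius M : ℂ) → ‖z‖ < specRadius M

section JointSpectralRadius

attribute [local instance] Matrix.linftyOpNormedAddCommGroup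

/-- The joint spectral radius
`limsup_{n → ∞} max_{i_1, …, i_n} ‖M_{i_1} ⋯ M_{i_n}‖ ^ (1 / n)` of a finite family of matrices,
computed with the (submultiplicative) operator norm of the supremum norm. -/
def jointSpecRadius {k d : ℕ} (M : Fin k → Matrix (Fin d) (Fin d) ℂ) : ℝ :=
  limsup (fun n : ℕ =>
    ⨆ w : Fin n → Fin k, ‖(List.ofFn fun j => M (w j)).prod‖ ^ (1 / (n : ℝ))) atTop

end JointSpectralRadius

/-- `Σ_f(n)`, the sum of `f` over the fundamental region `[k ^ n, k ^ (n + 1))`. -/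
def regionSum (k : ℕ) (f : ℕ → ℤ) (n : ℕ) : ℤ :=
  ∑ m ∈ Finset.Ico (k ^ n) (k ^ (n + 1)), f m

/-- The pure point measure `μ_{f,n}` on the circle `ℝ / ℤ`, for a non-negative sequence `f`:
the normalised values of `f` on `[k ^ n, k ^ (n + 1))`, placed at the points
`m / (k ^ n * (k - 1))`. -/
def approxMeasure (k : ℕ) (f : ℕ → ℤ) (n : ℕ) : Measure UnitAddCircle :=
  (ENNReal.ofReal (regionSum k f n : ℝ))⁻¹ •
    ∑ m ∈ Finset.range (k ^ (n + 1) - k ^ n),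
      ENNReal.ofReal (f (k ^ n + m) : ℝ) •
        Measure.dirac (((m : ℝ) / ((k : ℝ) ^ n * ((k : ℝ) - 1)) : ℝ) : UnitAddCircle)

/-- Weak convergence of measures on the circle. -/
def ConvergesWeakly (ν : ℕ → Measure UnitAddCircle) (μ : Measure UnitAddCircle) : Prop :=
  ∀ g : C(UnitAddCircle, ℝ), Tendsto (fun n => ∫ x, g x ∂(ν n)) atTop (𝓝 (∫ x, g x ∂μ))

/-- The distribution function `F : ℝ → ℝ` of a measure on `ℝ / ℤ`, identified with `[0, 1)`:
`F t = μ([0, t])`. So `F t = 0` for `t < 0`, and `F t` is the total mass for `t ≥ 1`. -/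
def distFun (μ : Measure UnitAddCircle) (t : ℝ) : ℝ :=
  μ.real ((fun s : ℝ => (s : UnitAddCircle)) '' Set.Icc 0 t)

/-- The quotient `log μ(B_r(x)) / log r`, in the extended reals with `log 0 = -∞`
(so it is `+∞` if `μ(B_r(x)) = 0` and `0 < r < 1`). -/
def localRatio (μ : Measure UnitAddCircle) (x : UnitAddCircle) (r : ℝ) : EReal :=
  ENNReal.log (μ (Metric.ball x r)) / ((Real.log r : ℝ) : EReal)

/-- The lower local dimension of `μ` at `x`. -/
def lowerLocalDim (μ : Measure UnitAddCircle) (x : UnitAddCircle) : EReal :=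
  liminf (fun r : ℝ => localRatio μ x r) (𝓝[>] 0)

end RegularSeq

end

open scoped Matrix

/-! Proposition: cut at `0`, a ball of radius `r < 1` is covered by three pieces of `[0, 1)`, each
of mass at most `C (2 r) ^ α`. Constant factors disappear on dividing logarithms by `log r`.

Corollary: let `V m` be the vector of values at `m` of the basis. Appending `n` arbitrary digits to
`M` and summing `V` gives `𝐁 ^ n V(M)` (`pow_apply_eq_blockSum`). Since `ρ` is the unique dominant
eigenvalue, `𝐁 ^ n / (n ^ j ρ ^ n)` converges to some `P ≠ 0` with `P 𝐁 = ρ P`. Hence the share of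
the total carried by the cell of a prefix `M` of `ℓ + 1` digits tends to `W(M) / ρ ^ ℓ`, provided
the normalised total has a limit `κ ≠ 0`. This is where positivity enters: if `κ = 0`, the block
sums of `f`, then those of every sequence in `𝒱_k(f)`, are negligible, so `P` kills every `V m`;
these vectors span, so `P = 0` (`exists_tendsto_blockSum_div_regionSum`).

Convergence of the cell masses makes integrals of continuous functions Cauchy, and compactness
supplies the limit measure. For `q > ρ*` one has `‖V M‖ ≤ C q ^ ℓ`, so cells of level `ℓ` have
limiting mass `O((q / ρ) ^ ℓ)`. A ball of radius about `k ^ (-ℓ)` meets boundedly many cells, so its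
mass is `O(r ^ log_k (ρ / q))` (`measure_ball_le_rpow`). This excludes atoms, and `q → ρ*` gives the
uniform dimension bound. -/

/-! ### Powers of an operator with a unique dominant eigenvalue. -/

theorem tendsto_choose_mul_pow_div_of_norm_lt {z : ℂ} {ρ : ℝ} (hz : ‖z‖ < ρ) (i j : ℕ) :
    Tendsto (fun n : ℕ => ((n : ℂ) ^ j * (ρ : ℂ) ^ n)⁻¹ * ((n.choose i : ℂ) * z ^ (n - i)))
      atTop (𝓝 0) := by
  have hρ : 0 < ρ := (norm_nonneg z).trans_lt hz
  rcases eq_or_ne z 0 with rfl | hz0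
  · refine tendsto_const_nhds.congr' ?_
    filter_upwards [eventually_gt_atTop i] with n hn
    rw [zero_pow (by omega)]; simp
  have hz0' : 0 < ‖z‖ := norm_pos_iff.2 hz0
  have hr : |‖z‖ / ρ| < 1 := by
    rw [abs_of_nonneg (by positivity), div_lt_one hρ]; exact hz
  have h := (tendsto_pow_const_mul_const_pow_of_abs_lt_one i hr).const_mul ((‖z‖ ^ i)⁻¹)
  rw [mul_zero] at h
  refine squeeze_zero_norm' ?_ h
  filter_upwards [eventually_ge_atTop (max i 1)] with n hn
  have hi : i ≤ n := (le_max_left _ _).trans hn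
  have h1 : 1 ≤ n := (le_max_right _ _).trans hn
  have hn1 : (1 : ℝ) ≤ (n : ℝ) ^ j := one_le_pow₀ (by exact_mod_cast h1)
  have hc : ((n.choose i : ℕ) : ℝ) ≤ (n : ℝ) ^ i := by exact_mod_cast Nat.choose_le_pow n i
  rw [norm_mul, norm_inv, norm_mul, norm_mul, norm_pow, norm_pow, norm_pow, Complex.norm_natCast,
    Complex.norm_natCast, Complex.norm_real, Real.norm_of_nonneg hρ.le]
  have e : ‖z‖ ^ (n - i) = ‖z‖ ^ n * (‖z‖ ^ i)⁻¹ := by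
    rw [pow_sub₀ _ hz0'.ne' hi]
  rw [e, div_pow]
  calc ((n : ℝ) ^ j * ρ ^ n)⁻¹ * ((n.choose i : ℝ) * (‖z‖ ^ n * (‖z‖ ^ i)⁻¹))
      ≤ (1 * ρ ^ n)⁻¹ * ((n : ℝ) ^ i * (‖z‖ ^ n * (‖z‖ ^ i)⁻¹)) := by gcongr
    _ = _ := by field_simp

theorem tendsto_choose_div_pow (i : ℕ) :
    Tendsto (fun n : ℕ => (n.choose i : ℂ) / (n : ℂ) ^ i) atTop (𝓝 ((i.factorial : ℂ)⁻¹)) := by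
  have h := isEquivalent_choose i
  have h2 : Tendsto (fun n : ℕ => (n.choose i : ℝ) / ((n : ℝ) ^ i / i.factorial)) atTop (𝓝 1) := by
    refine (Asymptotics.isEquivalent_iff_tendsto_one ?_).1 h
    filter_upwards [eventually_ge_atTop 1] with n hn
    positivity
  have h3 := (h2.const_mul ((i.factorial : ℝ)⁻¹)).ofReal
  simp only [mul_one] at h3
  refine (h3.congr fun n => ?_).trans (by simp)
  have : (i.factorial : ℂ) ≠ 0 := by exact_mod_cast i.factorial_ne_zero
  push_cast
  field_simp

theorem tendsto_choose_mul_pow_div {ρ : ℝ} (hρ : 0 < ρ) {i j : ℕ} (hij : i ≤ j) :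
    Tendsto (fun n : ℕ => ((n : ℂ) ^ j * (ρ : ℂ) ^ n)⁻¹ * ((n.choose i : ℂ) * (ρ : ℂ) ^ (n - i)))
      atTop (𝓝 (if i = j then ((j.factorial : ℂ) * (ρ : ℂ) ^ j)⁻¹ else 0)) := by
  have hρ' : (ρ : ℂ) ≠ 0 := by exact_mod_cast hρ.ne'
  have h1 : Tendsto (fun n : ℕ => ((n : ℂ) ^ (j - i))⁻¹) atTop (𝓝 (if i = j then 1 else 0)) := by
    split_ifs with h
    · simp [h]
    · have : Tendsto (fun n : ℕ => ((n : ℝ) ^ (j - i))⁻¹) atTop (𝓝 0) :=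
        ((tendsto_pow_atTop (by omega)).comp tendsto_natCast_atTop_atTop).inv_tendsto_atTop
      have h3 := this.ofReal
      simpa using h3
  have h2 := (h1.mul (tendsto_choose_div_pow i)).mul_const (((ρ : ℂ) ^ i)⁻¹)
  have e : (if i = j then (1 : ℂ) else 0) * (i.factorial : ℂ)⁻¹ * ((ρ : ℂ) ^ i)⁻¹ =
      if i = j then ((j.factorial : ℂ) * (ρ : ℂ) ^ j)⁻¹ else 0 := by
    split_ifs with h
    · subst h; rw [mul_inv]; ring
    · simp
  rw [e] at h2
  refine h2.congr' ?_
  filter_upwards [eventually_ge_atTop (max i 1)] with n hn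
  have hi : i ≤ n := (le_max_left _ _).trans hn
  have h1 : 1 ≤ n := (le_max_right _ _).trans hn
  have hn0 : (n : ℂ) ≠ 0 := by exact_mod_cast (show n ≠ 0 by omega)
  rw [pow_sub₀ _ hρ' hi, pow_sub₀ _ hn0 hij]
  field_simp

section
variable {V : Type*} [AddCommGroup V] [Module ℂ V]

/-- Binomial expansion of `(z + N) ^ n`, cut off at `D` because `N ^ D` kills `u`. -/
theorem Module.End.pow_apply_eq_sum (T : Module.End ℂ V) (z : ℂ) {D : ℕ} {u : V}
    (hu : ((T - z • (1 : Module.End ℂ V)) ^ D) u = 0) {n : ℕ} (hn : D ≤ n + 1) :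
    (T ^ n) u = ∑ i ∈ Finset.range D,
      ((n.choose i : ℂ) * z ^ (n - i)) • ((T - z • (1 : Module.End ℂ V)) ^ i) u := by
  set N := T - z • (1 : Module.End ℂ V) with hN
  have hT : T = N + z • (1 : Module.End ℂ V) := by rw [hN]; abel
  have hc : Commute N (z • (1 : Module.End ℂ V)) := (Commute.one_right N).smul_right z
  conv_lhs => rw [hT, hc.add_pow]
  rw [LinearMap.sum_apply, ← Finset.sum_subset (Finset.range_mono hn)]
  · refine Finset.sum_congr rfl fun i _ => ?_
    rw [smul_pow, one_pow, mul_smul_comm, mul_one, smul_mul_assoc, LinearMap.smul_apply,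
      ← Nat.cast_comm, mul_comm (n.choose i : ℂ), mul_smul]
    congr 1
    rw [← nsmul_eq_mul, LinearMap.smul_apply, Nat.cast_smul_eq_nsmul]
  · intro i _ hi
    have hD : D ≤ i := by simpa using hi
    have h0 : (N ^ i) u = 0 := by
      rw [← Nat.sub_add_cancel hD, pow_add, Module.End.mul_apply, hu, map_zero]
    rw [smul_pow, one_pow, mul_smul_comm, mul_one, smul_mul_assoc, LinearMap.smul_apply,
      ← Nat.cast_comm, ← nsmul_eq_mul, LinearMap.smul_apply, h0, smul_zero, smul_zero]

end

section
variable {V : Type*} [NormedAddCommGroup V] [NormedSpace ℂ V] [FiniteDimensional ℂ V]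

/-- The normalised powers of an endomorphism with a unique dominant eigenvalue converge to a
non-zero linear map. -/
theorem Module.End.exists_tendsto_normalized_pow (T : Module.End ℂ V) {ρ : ℝ} (hρ : 0 < ρ)
    (hev : T.HasEigenvalue (ρ : ℂ)) (hdom : ∀ z, T.HasEigenvalue z → z ≠ (ρ : ℂ) → ‖z‖ < ρ) :
    ∃ (j : ℕ) (P : V →ₗ[ℂ] V), P ≠ 0 ∧ ∀ u, Tendsto
      (fun n : ℕ => ((n : ℂ) ^ j * (ρ : ℂ) ^ n)⁻¹ • (T ^ n) u) atTop (𝓝 (P u)) := by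
  classical
  set N := T - (ρ : ℂ) • (1 : Module.End ℂ V) with hN
  have hex : ∃ D : ℕ, ∀ u ∈ T.maxGenEigenspace (ρ : ℂ), (N ^ D) u = 0 := by
    refine ⟨Module.finrank ℂ V, fun u hu => ?_⟩
    rw [Module.End.maxGenEigenspace_eq_genEigenspace_finrank] at hu
    rw [Module.End.mem_genEigenspace_nat] at hu
    exact hu
  -- With `D` minimal and `j = D - 1`, only the term `N ^ j` of the expansion survives division by
  -- `n ^ j ρ ^ n`. Minimality of `D` is what makes the limit non-zero.
  set D := Nat.find hex with hD
  have hDspec := Nat.find_spec hex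
  obtain ⟨x, hx⟩ := hev.exists_hasEigenvector
  have hxE : x ∈ T.maxGenEigenspace (ρ : ℂ) := by
    rw [Module.End.mem_maxGenEigenspace]
    refine ⟨1, ?_⟩
    rw [pow_one, LinearMap.sub_apply, LinearMap.smul_apply, Module.End.one_apply, hx.apply_eq_smul,
      sub_self]
  have hD0 : D ≠ 0 := by
    intro h0
    have := hDspec x hxE
    rw [← hD, h0, pow_zero, Module.End.one_apply] at this
    exact hx.2 this
  obtain ⟨j, hj⟩ := Nat.exists_eq_succ_of_ne_zero hD0
  have hlim : ∀ u ∈ T.maxGenEigenspace (ρ : ℂ), Tendsto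
      (fun n : ℕ => ((n : ℂ) ^ j * (ρ : ℂ) ^ n)⁻¹ • (T ^ n) u) atTop
      (𝓝 (((j.factorial : ℂ) * (ρ : ℂ) ^ j)⁻¹ • (N ^ j) u)) := by
    intro u hu
    have hs : Tendsto (fun n : ℕ => ∑ i ∈ Finset.range (j + 1),
        (((n : ℂ) ^ j * (ρ : ℂ) ^ n)⁻¹ * ((n.choose i : ℂ) * (ρ : ℂ) ^ (n - i))) • (N ^ i) u)
        atTop (𝓝 (∑ i ∈ Finset.range (j + 1),
          (if i = j then ((j.factorial : ℂ) * (ρ : ℂ) ^ j)⁻¹ else 0) • (N ^ i) u)) :=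
      tendsto_finsetSum _ fun i hi =>
        (tendsto_choose_mul_pow_div hρ (Nat.lt_succ_iff.1 (Finset.mem_range.1 hi))).smul_const _
    have e : ∑ i ∈ Finset.range (j + 1),
          (if i = j then ((j.factorial : ℂ) * (ρ : ℂ) ^ j)⁻¹ else 0) • (N ^ i) u =
        ((j.factorial : ℂ) * (ρ : ℂ) ^ j)⁻¹ • (N ^ j) u := by
      simp [ite_smul]
    rw [e] at hs
    refine hs.congr' ?_
    filter_upwards [eventually_ge_atTop j] with n hn
    have h0 : (N ^ (j + 1)) u = 0 := by
      have := hDspec u hu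
      rwa [← hD, hj] at this
    rw [Module.End.pow_apply_eq_sum T (ρ : ℂ) h0 (by omega), Finset.smul_sum]
    simp only [smul_smul]
    rfl
  have hall : ∀ u : V, ∃ w, Tendsto
      (fun n : ℕ => ((n : ℂ) ^ j * (ρ : ℂ) ^ n)⁻¹ • (T ^ n) u) atTop (𝓝 w) := by
    intro u
    have hu : u ∈ ⨆ z : ℂ, T.maxGenEigenspace z := by
      rw [Module.End.iSup_maxGenEigenspace_eq_top]; trivial
    induction hu using Submodule.iSup_induction' with
    | zero => exact ⟨0, by simp⟩
    | add x y _ _ hx hy =>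
      obtain ⟨w, hw⟩ := hx
      obtain ⟨w', hw'⟩ := hy
      exact ⟨w + w', by simpa only [map_add, smul_add] using hw.add hw'⟩
    | mem z u hu =>
      rcases eq_or_ne z (ρ : ℂ) with rfl | hz
      · exact ⟨_, hlim u hu⟩
      rcases eq_or_ne u 0 with rfl | hu0
      · exact ⟨0, by simp⟩
      have hzev : T.HasEigenvalue z := by
        rw [Module.End.hasEigenvalue_iff]
        intro hbot
        rw [Module.End.maxGenEigenspace_eq_genEigenspace_finrank] at hu
        have := Module.End.hasEigenvalue_of_hasGenEigenvalue (f := T) (μ := z)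
          (k := Module.finrank ℂ V) (by
            intro h
            rw [h] at hu
            exact hu0 (by simpa using hu))
        exact (Module.End.hasEigenvalue_iff.1 this) hbot
      obtain ⟨E, hE⟩ := (Module.End.mem_maxGenEigenspace T z u).1 hu
      have hs : Tendsto (fun n : ℕ => ∑ i ∈ Finset.range E,
          (((n : ℂ) ^ j * (ρ : ℂ) ^ n)⁻¹ * ((n.choose i : ℂ) * z ^ (n - i))) •
            ((T - z • (1 : Module.End ℂ V)) ^ i) u)
          atTop (𝓝 (∑ i ∈ Finset.range E, (0 : ℂ) • ((T - z • (1 : Module.End ℂ V)) ^ i) u)) :=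
        tendsto_finsetSum _ fun i _ =>
          (tendsto_choose_mul_pow_div_of_norm_lt (hdom z hzev hz) i j).smul_const _
      refine ⟨_, hs.congr' ?_⟩
      filter_upwards [eventually_ge_atTop E] with n hn
      rw [Module.End.pow_apply_eq_sum T z hE (by omega), Finset.smul_sum]
      simp only [smul_smul]
  choose P hP using hall
  refine ⟨j, { toFun := P, map_add' := fun x y => ?_, map_smul' := fun c x => ?_ }, ?_, hP⟩
  · refine tendsto_nhds_unique (hP (x + y)) ?_
    simpa only [map_add, smul_add] using (hP x).add (hP y)
  · refine tendsto_nhds_unique (hP (c • x)) ?_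
    simpa only [map_smul, smul_comm c, RingHom.id_apply] using (hP x).const_smul c
  · intro h
    refine Nat.find_min hex (m := j) (by omega) fun u hu => ?_
    have h1 := tendsto_nhds_unique (hP u) (hlim u hu)
    have h2 : P u = 0 := LinearMap.congr_fun h u
    rw [h2, eq_comm, smul_eq_zero] at h1
    refine h1.resolve_left (inv_ne_zero (mul_ne_zero ?_ (pow_ne_zero _ ?_)))
    · exact_mod_cast j.factorial_ne_zero
    · exact_mod_cast hρ.ne'
end

/-! ### Mass of balls, local dimension and Hölder distribution functions. -/

namespace RegularSeq

theorem exists_localRatio_ge {μ : Measure UnitAddCircle} {C β r₁ : ℝ} (hC : 0 < C) (hr₁ : 0 < r₁)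
    (hμ : ∀ x r, 0 < r → r < r₁ → μ (Metric.ball x r) ≤ ENNReal.ofReal (C * r ^ β))
    {ε : ℝ} (hε : 0 < ε) :
    ∃ r₀ : ℝ, 0 < r₀ ∧ ∀ r : ℝ, 0 < r → r < r₀ → ∀ x : UnitAddCircle,
      ((β - ε : ℝ) : EReal) ≤ localRatio μ x r := by
  -- Below the exponential, `log C < -ε log r`, so the constant costs at most `ε` in the exponent;
  -- `r < 1` makes `log r` negative, which reverses the inequality on division.
  refine ⟨min (min r₁ 1) (Real.exp (-Real.log C / ε)), by positivity, fun r hr hr0 x => ?_⟩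
  have h1 : r < r₁ := hr0.trans_le ((min_le_left _ _).trans (min_le_left _ _))
  have h2 : r < 1 := hr0.trans_le ((min_le_left _ _).trans (min_le_right _ _))
  have h3 : r < Real.exp (-Real.log C / ε) := hr0.trans_le (min_le_right _ _)
  have hl : Real.log r < 0 := Real.log_neg hr h2
  have h4 : Real.log r < -Real.log C / ε := (Real.log_lt_iff_lt_exp hr).2 h3
  rw [lt_div_iff₀ hε] at h4
  have hpos : 0 < C * r ^ β := mul_pos hC (Real.rpow_pos_of_pos hr _)
  have h5 : ENNReal.log (μ (Metric.ball x r)) ≤ (((β - ε) * Real.log r : ℝ) : EReal) := by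
    refine (ENNReal.log_le_log (hμ x r hr h1)).trans ?_
    rw [ENNReal.log_ofReal, if_neg hpos.not_ge, EReal.coe_le_coe_iff,
      Real.log_mul hC.ne' (Real.rpow_pos_of_pos hr _).ne', Real.log_rpow hr]
    linarith
  have h6 := EReal.div_le_div_right_of_nonpos (c := ((Real.log r : ℝ) : EReal))
    (by exact_mod_cast hl.le) h5
  rwa [← EReal.coe_div, mul_div_cancel_right₀ _ hl.ne] at h6

theorem le_lowerLocalDim {μ : Measure UnitAddCircle} {β : ℝ}
    (h : ∀ ε : ℝ, 0 < ε → ∃ r₀ : ℝ, 0 < r₀ ∧ ∀ r : ℝ, 0 < r → r < r₀ → ∀ x : UnitAddCircle,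
      ((β - ε : ℝ) : EReal) ≤ localRatio μ x r) (x : UnitAddCircle) :
    (β : EReal) ≤ lowerLocalDim μ x := by
  refine EReal.ge_of_forall_gt_iff_ge.1 fun z hz => ?_
  have hz' : z < β := by exact_mod_cast hz
  obtain ⟨r₀, hr₀, H⟩ := h (β - z) (sub_pos.2 hz')
  refine le_liminf_of_le (f := 𝓝[>] 0) (u := fun r => localRatio μ x r) (by isBoundedDefault) ?_
  filter_upwards [Ioo_mem_nhdsGT hr₀] with r hr
  simpa using H r hr.1 hr.2 x

theorem exists_mem_Ioo_of_mem_ball {t r : ℝ} {y : UnitAddCircle}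
    (hy : y ∈ Metric.ball (t : UnitAddCircle) r) :
    ∃ s ∈ Set.Ioo (t - r) (t + r), (s : UnitAddCircle) = y := by
  obtain ⟨s, rfl⟩ := QuotientAddGroup.mk_surjective y
  rw [Metric.mem_ball, dist_eq_norm] at hy
  have h : ‖((s - t : ℝ) : UnitAddCircle)‖ < r := hy
  rw [UnitAddCircle.norm_eq, abs_lt] at h
  refine ⟨s - round (s - t), ⟨by linarith, by linarith⟩, ?_⟩
  rw [AddCircle.coe_sub]
  have : ((round (s - t) : ℝ) : UnitAddCircle) = 0 := by
    rw [AddCircle.coe_eq_zero_iff]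
    exact ⟨round (s - t), by simp⟩
  rw [this, sub_zero]

theorem injOn_coe_Ico : Set.InjOn (fun s : ℝ => (s : UnitAddCircle)) (Set.Ico 0 1) := by
  intro a ha b hb h
  have h' : ((a : ℝ) : AddCircle (1 : ℝ)) = (b : AddCircle (1 : ℝ)) := h
  exact (AddCircle.coe_eq_coe_iff_of_mem_Ico (p := (1 : ℝ)) (a := 0) (by simpa using ha)
    (by simpa using hb)).1 h'

theorem measurableSet_coe_image_Icc (a b : ℝ) :
    MeasurableSet ((fun s : ℝ => (s : UnitAddCircle)) '' Set.Icc a b) :=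
  (isCompact_Icc.image (AddCircle.continuous_mk' 1)).isClosed.measurableSet

theorem measureReal_coe_image_le (μ : Measure UnitAddCircle) [IsFiniteMeasure μ] {a b : ℝ}
    (hab : a ≤ b) :
    μ.real ((fun s : ℝ => (s : UnitAddCircle)) '' (Set.Ioc a b ∩ Set.Ico 0 1)) ≤
      distFun μ b - distFun μ a := by
  have hle : (fun s : ℝ => (s : UnitAddCircle)) '' Set.Icc 0 a ⊆
      (fun s : ℝ => (s : UnitAddCircle)) '' Set.Icc 0 b :=
    Set.image_mono (Set.Icc_subset_Icc_right hab)
  rw [distFun, distFun, ← measureReal_sdiff hle (measurableSet_coe_image_Icc 0 a)]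
  -- For `a < 1` the arc is disjoint from the image of `[0, a]` by injectivity on `[0, 1)`; for `a ≥
  -- 1` no part of it lies in `[0, 1)`.
  rcases lt_or_ge a 1 with ha | ha
  · refine measureReal_mono ?_
    rintro _ ⟨s, ⟨⟨h1, h2⟩, h3⟩, rfl⟩
    refine ⟨⟨s, ⟨h3.1, h2⟩, rfl⟩, ?_⟩
    rintro ⟨s', ⟨h4, h5⟩, h6⟩
    have := injOn_coe_Ico ⟨h4, h5.trans_lt ha⟩ h3 h6
    linarith
  · have : Set.Ioc a b ∩ Set.Ico (0 : ℝ) 1 = ∅ := by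
      ext s
      simp only [Set.mem_inter_iff, Set.mem_Ioc, Set.mem_Ico, Set.mem_empty_iff_false, iff_false]
      intro h
      linarith [h.1.1, h.2.2]
    rw [this]
    simp

theorem measureReal_ball_le_of_holderWith {μ : Measure UnitAddCircle} [IsFiniteMeasure μ]
    {C α : NNReal} (h : HolderWith C α (distFun μ)) (x : UnitAddCircle) {r : ℝ} (hr : 0 < r)
    (hr1 : r < 1) : μ.real (Metric.ball x r) ≤ 3 * (C * (2 * r) ^ (α : ℝ)) := by
  obtain ⟨t, ht, rfl⟩ : ∃ t ∈ Set.Ico (0 : ℝ) 1, (t : UnitAddCircle) = x := by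
    have : x ∈ (Set.univ : Set UnitAddCircle) := trivial
    rw [← AddCircle.coe_image_Ico_eq (1 : ℝ) 0] at this
    obtain ⟨t, ht, rfl⟩ := this
    exact ⟨t, by simpa using ht, rfl⟩
  -- Lifts of the ball lie in `(t - r, t + r) ⊆ (-1, 2)`, so shifts by `0`, `1` and `-1` bring all
  -- of them into `[0, 1)`.
  set J : ℝ → Set UnitAddCircle := fun c =>
    (fun s : ℝ => (s : UnitAddCircle)) '' (Set.Ioc (t - r + c) (t + r + c) ∩ Set.Ico 0 1) with hJ
  have hJle : ∀ c, μ.real (J c) ≤ C * (2 * r) ^ (α : ℝ) := by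
    intro c
    refine (measureReal_coe_image_le μ (by linarith)).trans ?_
    have := h.dist_le (t + r + c) (t - r + c)
    rw [Real.dist_eq, Real.dist_eq, show t + r + c - (t - r + c) = 2 * r by ring,
      abs_of_pos (by linarith : 0 < 2 * r)] at this
    exact (le_abs_self _).trans this
  have hsub : Metric.ball (t : UnitAddCircle) r ⊆ J 0 ∪ J 1 ∪ J (-1) := by
    intro y hy
    obtain ⟨s, ⟨h1, h2⟩, rfl⟩ := exists_mem_Ioo_of_mem_ball hy
    rcases lt_or_ge s 0 with hs | hs
    · refine Or.inl (Or.inr ⟨s + 1, ⟨⟨by linarith, by linarith⟩, by linarith [ht.1], by linarith⟩, ?_⟩)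
      simp
    · rcases lt_or_ge s 1 with hs1 | hs1
      · exact Or.inl (Or.inl ⟨s, ⟨⟨by linarith, by linarith⟩, hs, hs1⟩, rfl⟩)
      · refine Or.inr ⟨s - 1, ⟨⟨by linarith, by linarith⟩, by linarith, by linarith [ht.2]⟩, ?_⟩
        simp
  calc μ.real (Metric.ball (t : UnitAddCircle) r) ≤ μ.real (J 0 ∪ J 1 ∪ J (-1)) :=
        measureReal_mono hsub
    _ ≤ μ.real (J 0) + μ.real (J 1) + μ.real (J (-1)) :=
        (measureReal_union_le _ _).trans (add_le_add_left (measureReal_union_le _ _) _)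
    _ ≤ _ := by linarith [hJle 0, hJle 1, hJle (-1)]

theorem le_lowerLocalDim_of_holderWith {μ : Measure UnitAddCircle} [IsFiniteMeasure μ]
    {C α : NNReal} (h : HolderWith C α (distFun μ)) (x : UnitAddCircle) :
    ((α : ℝ) : EReal) ≤ lowerLocalDim μ x := by
  refine le_lowerLocalDim (fun ε hε => ?_) x
  refine exists_localRatio_ge (C := 3 * (C + 1) * 2 ^ (α : ℝ)) (r₁ := 1) (by positivity) one_pos
    (fun x r hr hr1 => ?_) hε
  rw [← ofReal_measureReal]
  refine ENNReal.ofReal_le_ofReal ((measureReal_ball_le_of_holderWith h x hr hr1).trans ?_)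
  rw [Real.mul_rpow zero_le_two hr.le]
  have : 0 ≤ (2 : ℝ) ^ (α : ℝ) * r ^ (α : ℝ) := by positivity
  linarith

end RegularSeq

/-- The normalising factors at `n + 1` and `n` have ratio `((n + 1) / n) ^ j * ρ`, which tends to
`ρ`. -/
theorem Module.End.comp_eq_smul_of_tendsto_normalized_pow {V : Type*} [NormedAddCommGroup V]
    [NormedSpace ℂ V] {T : Module.End ℂ V} {ρ : ℝ} (hρ : 0 < ρ) {j : ℕ} {P : V →ₗ[ℂ] V}
    (hP : ∀ u, Tendsto (fun n : ℕ => ((n : ℂ) ^ j * (ρ : ℂ) ^ n)⁻¹ • (T ^ n) u) atTop (𝓝 (P u)))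
    (u : V) : P (T u) = (ρ : ℂ) • P u := by
  have hρ' : (ρ : ℂ) ≠ 0 := by exact_mod_cast hρ.ne'
  have h1 : Tendsto (fun n : ℕ => (((n + 1 : ℕ) : ℂ) / (n : ℂ)) ^ j * (ρ : ℂ)) atTop
      (𝓝 ((1 : ℂ) ^ j * ρ)) := by
    refine Tendsto.mul_const _ (Tendsto.pow ?_ j)
    have h := (tendsto_natCast_div_add_atTop (1 : ℝ)).inv₀ one_ne_zero
    have h' := h.ofReal
    simpa using h'
  have h2 := h1.smul ((hP u).comp (tendsto_add_atTop_nat 1))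
  rw [one_pow, one_mul] at h2
  refine tendsto_nhds_unique (hP (T u)) (h2.congr' ?_)
  filter_upwards [eventually_ge_atTop 1] with n hn
  have hn0 : (n : ℂ) ≠ 0 := by exact_mod_cast (show n ≠ 0 by omega)
  have hn1 : ((n + 1 : ℕ) : ℂ) ≠ 0 := by exact_mod_cast n.succ_ne_zero
  rw [Function.comp_apply, smul_smul, pow_succ T, Module.End.mul_apply]
  congr 1
  rw [div_pow]
  field_simp
  ring

/-! ### Growth bounds from the joint spectral radius. -/

namespace RegularSeq

section
variable {k d : ℕ}

attribute [local instance] Matrix.linftyOpNormedAddCommGroup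

theorem exists_norm_prod_ofFn_le (M : Fin k → Matrix (Fin d) (Fin d) ℂ) :
    ∃ b m : ℝ, 1 ≤ b ∧ 1 ≤ m ∧ ∀ (n : ℕ) (w : Fin n → Fin k),
      ‖(List.ofFn fun j => M (w j)).prod‖ ≤ b * m ^ n := by
  refine ⟨‖(1 : Matrix (Fin d) (Fin d) ℂ)‖ + 1, ∑ a, ‖M a‖ + 1, by simp, ?_, fun n => ?_⟩
  · simpa using Finset.sum_nonneg fun a _ => norm_nonneg (M a)
  induction n with
  | zero => intro w; simp
  | succ n ih =>
    intro w
    have h1 : ‖M (w 0)‖ ≤ ∑ a, ‖M a‖ + 1 :=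
      (Finset.single_le_sum (f := fun a => ‖M a‖) (fun a _ => norm_nonneg (M a))
        (Finset.mem_univ (w 0))).trans (by simp)
    rw [List.ofFn_succ, List.prod_cons, pow_succ']
    have h2 := Matrix.linfty_opNorm_mul (M (w 0)) (List.ofFn fun j : Fin n => M (w j.succ)).prod
    calc _ ≤ ‖M (w 0)‖ * ‖(List.ofFn fun j : Fin n => M (w j.succ)).prod‖ := h2
      _ ≤ (∑ a, ‖M a‖ + 1) * ((‖(1 : Matrix (Fin d) (Fin d) ℂ)‖ + 1) * (∑ a, ‖M a‖ + 1) ^ n) :=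
          mul_le_mul h1 (ih fun j => w j.succ) (norm_nonneg _) ((norm_nonneg _).trans h1)
      _ = _ := by ring

/-- The real-valued `limsup` carries information only for a bounded sequence; submultiplicativity
gives the bound. -/
theorem isBoundedUnder_jointSpecRadius [NeZero k] (M : Fin k → Matrix (Fin d) (Fin d) ℂ) :
    IsBoundedUnder (· ≤ ·) atTop (fun n : ℕ =>
      ⨆ w : Fin n → Fin k, ‖(List.ofFn fun j => M (w j)).prod‖ ^ (1 / (n : ℝ))) := by
  obtain ⟨b, m, hb, hm, H⟩ := exists_norm_prod_ofFn_le M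
  refine isBoundedUnder_of_eventually_le (a := b * m) ?_
  filter_upwards [eventually_ge_atTop 1] with n hn
  refine ciSup_le fun w => ?_
  have hn' : (1 : ℝ) ≤ n := by exact_mod_cast hn
  calc ‖(List.ofFn fun j => M (w j)).prod‖ ^ (1 / (n : ℝ)) ≤ (b * m ^ n) ^ (1 / (n : ℝ)) :=
        Real.rpow_le_rpow (norm_nonneg _) (H n w) (by positivity)
    _ = b ^ (1 / (n : ℝ)) * m := by
        rw [Real.mul_rpow (by positivity) (by positivity), one_div,
          Real.pow_rpow_inv_natCast (by positivity) (by omega)]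
    _ ≤ b ^ (1 : ℝ) * m := by
        gcongr
        rw [div_le_one (by positivity)]
        exact hn'
    _ = b * m := by rw [Real.rpow_one]

theorem jointSpecRadius_nonneg [NeZero k] (M : Fin k → Matrix (Fin d) (Fin d) ℂ) :
    0 ≤ jointSpecRadius M :=
  le_limsup_of_frequently_le
    (Frequently.of_forall fun n => Real.iSup_nonneg fun w => by positivity)
    (isBoundedUnder_jointSpecRadius M)

theorem exists_norm_prod_le_of_jointSpecRadius_lt [NeZero k]
    {M : Fin k → Matrix (Fin d) (Fin d) ℂ} {q : ℝ} (hq : jointSpecRadius M < q) :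
    ∃ C : ℝ, 0 < C ∧ ∀ (n : ℕ) (w : Fin n → Fin k),
      ‖(List.ofFn fun j => M (w j)).prod‖ ≤ C * q ^ n := by
  have hq0 : 0 < q := (jointSpecRadius_nonneg M).trans_lt hq
  obtain ⟨b, m, hb, hm, H⟩ := exists_norm_prod_ofFn_le M
  obtain ⟨N, hN⟩ := eventually_atTop.1
    (eventually_lt_of_limsup_lt hq (isBoundedUnder_jointSpecRadius M))
  have hs : ∀ n, 0 ≤ b * m ^ n / q ^ n := fun n => by positivity
  have hs' : 0 ≤ ∑ n ∈ Finset.range (N + 1), b * m ^ n / q ^ n :=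
    Finset.sum_nonneg fun n _ => hs n
  -- The `1` serves lengths beyond `N`, where the definition of the limsup applies; the sum absorbs
  -- the finitely many shorter products.
  refine ⟨1 + ∑ n ∈ Finset.range (N + 1), b * m ^ n / q ^ n, by linarith, fun n w => ?_⟩
  rcases le_or_gt n N with hn | hn
  · have h1 := Finset.single_le_sum (fun n _ => hs n) (Finset.mem_range.2 (Nat.lt_succ_of_le hn))
    calc _ ≤ b * m ^ n := H n w
      _ = (b * m ^ n / q ^ n) * q ^ n := by field_simp
      _ ≤ _ := by gcongr; linarith
  · have h1 : ‖(List.ofFn fun j => M (w j)).prod‖ ^ (1 / (n : ℝ)) < q :=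
      (le_ciSup (f := fun w : Fin n → Fin k =>
        ‖(List.ofFn fun j => M (w j)).prod‖ ^ (1 / (n : ℝ))) (Set.finite_range _).bddAbove
        w).trans_lt (hN n hn.le)
    have h2 : ‖(List.ofFn fun j => M (w j)).prod‖ ≤ q ^ n := by
      have := pow_le_pow_left₀ (by positivity) h1.le n
      rwa [one_div, Real.rpow_inv_natCast_pow (norm_nonneg _) (by omega)] at this
    refine h2.trans (le_mul_of_one_le_left (by positivity) (by linarith))

/-- The values of a vector sequence generated by digit matrices on `[k ^ ℓ, k ^ (ℓ + 1))`. -/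
theorem exists_eq_prod_mulVec {M : Fin k → Matrix (Fin d) (Fin d) ℂ} {V : ℕ → Fin d → ℂ}
    (hV : ∀ (a : Fin k) m, V (k * m + a) = M a *ᵥ V m) (ℓ : ℕ) :
    ∀ m, k ^ ℓ ≤ m → m < k ^ (ℓ + 1) → ∃ (w : Fin ℓ → Fin k) (a : Fin k),
      V m = (List.ofFn fun j => M (w j)).prod *ᵥ V a := by
  induction ℓ with
  | zero =>
    intro m _ h
    exact ⟨Fin.elim0, ⟨m, by simpa using h⟩, by simp⟩
  | succ ℓ ih =>
    intro m h1 h2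
    have hk : 0 < k := by
      rcases Nat.eq_zero_or_pos k with rfl | h
      · simp at h2
      · exact h
    obtain ⟨w, a, hw⟩ := ih (m / k) ((Nat.le_div_iff_mul_le hk).2 (by rwa [← pow_succ]))
      ((Nat.div_lt_iff_lt_mul hk).2 (by rwa [← pow_succ]))
    -- The last digit acts last, so its matrix is the leftmost factor; `a` is the leading digit.
    refine ⟨Fin.cons ⟨m % k, Nat.mod_lt _ hk⟩ w, a, ?_⟩
    have h3 := hV ⟨m % k, Nat.mod_lt _ hk⟩ (m / k)
    rw [Nat.div_add_mod] at h3
    rw [h3, hw, Matrix.mulVec_mulVec, List.ofFn_succ, List.prod_cons]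
    simp

theorem exists_norm_le_of_jointSpecRadius_lt [NeZero k] {M : Fin k → Matrix (Fin d) (Fin d) ℂ}
    {V : ℕ → Fin d → ℂ} (hV : ∀ (a : Fin k) m, V (k * m + a) = M a *ᵥ V m) {q : ℝ}
    (hq : jointSpecRadius M < q) :
    ∃ C : ℝ, 0 < C ∧ ∀ ℓ m, k ^ ℓ ≤ m → m < k ^ (ℓ + 1) → ‖V m‖ ≤ C * q ^ ℓ := by
  obtain ⟨C, hC, H⟩ := exists_norm_prod_le_of_jointSpecRadius_lt hq
  have hq0 : 0 < q := (jointSpecRadius_nonneg M).trans_lt hq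
  have hs : 0 ≤ ∑ a : Fin k, ‖V a‖ := Finset.sum_nonneg fun a _ => norm_nonneg _
  refine ⟨C * (∑ a : Fin k, ‖V a‖ + 1), by positivity, fun ℓ m h1 h2 => ?_⟩
  obtain ⟨w, a, hw⟩ := exists_eq_prod_mulVec hV ℓ m h1 h2
  have h3 : ‖V a‖ ≤ ∑ a : Fin k, ‖V a‖ + 1 :=
    (Finset.single_le_sum (f := fun a : Fin k => ‖V a‖) (fun a _ => norm_nonneg _)
      (Finset.mem_univ a)).trans (by simp)
  rw [hw]
  calc _ ≤ ‖(List.ofFn fun j => M (w j)).prod‖ * ‖V a‖ := Matrix.linfty_opNorm_mulVec _ _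
    _ ≤ (C * q ^ ℓ) * (∑ a : Fin k, ‖V a‖ + 1) :=
        mul_le_mul (H ℓ w) h3 (norm_nonneg _) (by positivity)
    _ = _ := by ring

end

/-! ### Sums over integers with a given digit prefix. -/

section
variable {A : Type*} [AddCommMonoid A]

theorem sum_Ico_mul_eq (g : ℕ → A) (c a : ℕ) {b : ℕ} (hab : a ≤ b) :
    ∑ m ∈ Finset.Ico (c * a) (c * b), g m =
      ∑ i ∈ Finset.Ico a b, ∑ m ∈ Finset.Ico (c * i) (c * (i + 1)), g m := by
  induction b, hab using Nat.le_induction with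
  | base => simp
  | succ b hab ih =>
    rw [Finset.sum_Ico_succ_top hab, ← ih,
      Finset.sum_Ico_consecutive _ (Nat.mul_le_mul_left c hab) (Nat.mul_le_mul_left c b.le_succ)]

/-- The sum of `g` over the integers whose base-`k` expansion is that of `M` followed by `n`
further digits. -/
def blockSum (k : ℕ) (g : ℕ → A) (M n : ℕ) : A :=
  ∑ m ∈ Finset.Ico (k ^ n * M) (k ^ n * (M + 1)), g m

theorem blockSum_add (k : ℕ) (g : ℕ → A) (M n ℓ : ℕ) :
    blockSum k g M (n + ℓ) = blockSum k (fun m => blockSum k g m n) M ℓ := by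
  unfold blockSum
  rw [pow_add, mul_assoc, mul_assoc, sum_Ico_mul_eq _ _ _ (Nat.mul_le_mul_left _ M.le_succ)]

theorem map_blockSum {A' F : Type*} [AddCommMonoid A'] [FunLike F A A'] [AddMonoidHomClass F A A']
    (φ : F) (k : ℕ) (g : ℕ → A) (M n : ℕ) :
    φ (blockSum k g M n) = blockSum k (fun m => φ (g m)) M n :=
  map_sum φ _ _

end

/-- Sort the integers with `n + ℓ + 1` digits by their first `ℓ + 1` digits. -/
theorem sum_region_eq {A : Type*} [AddCommMonoid A] {k : ℕ} (hk : 2 ≤ k) (g : ℕ → A) (n ℓ : ℕ) :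
    ∑ m ∈ Finset.Ico (k ^ (n + ℓ)) (k ^ (n + ℓ + 1)), g m =
      ∑ M ∈ Finset.Ico (k ^ ℓ) (k ^ (ℓ + 1)), blockSum k g M n := by
  unfold blockSum
  rw [← sum_Ico_mul_eq _ _ _ (Nat.pow_le_pow_right (by omega) ℓ.le_succ), ← pow_add, ← pow_add,
    add_assoc]

/-- One application of the sum of the digit matrices sums over one appended digit. -/
theorem pow_apply_eq_blockSum {k d : ℕ} {M : Fin k → Matrix (Fin d) (Fin d) ℂ} {V : ℕ → Fin d → ℂ}
    (hV : ∀ (a : Fin k) m, V (k * m + a) = M a *ᵥ V m) (m n : ℕ) :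
    ((Matrix.toLin' (∑ a, M a)) ^ n) (V m) = blockSum k V m n := by
  induction n with
  | zero => simp [blockSum]
  | succ n ih =>
    rw [pow_succ', Module.End.mul_apply, ih, map_blockSum, add_comm, blockSum_add]
    congr 1
    funext i
    rw [Matrix.toLin'_apply, Matrix.sum_mulVec, blockSum, pow_one, Finset.sum_Ico_eq_sum_range,
      mul_add, mul_one, Nat.add_sub_cancel_left, Finset.sum_range]
    exact Finset.sum_congr rfl fun a _ => (hV a i).symm

end RegularSeq

/-! ### Limits of normalised block sums of a positive regular sequence. -/

namespace RegularSeq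

theorem mem_kernelSpace (k : ℕ) (f : ℕ → ℤ) : (fun n => (f n : ℚ)) ∈ kernelSpace k f :=
  Submodule.subset_span ⟨0, 0, by simp, by simp⟩

section
variable {k d : ℕ} {f : ℕ → ℤ}

/-- The vector `(f_1(m), …, f_d(m))` of the values of a basis, regarded as a complex vector. -/
noncomputable def basisVec (b : Module.Basis (Fin d) ℚ (kernelSpace k f)) (m : ℕ) : Fin d → ℂ :=
  fun i => (((b i : ℕ → ℚ) m : ℚ) : ℂ)

theorem basisVec_mul_add {b : Module.Basis (Fin d) ℚ (kernelSpace k f)}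
    {B : Fin k → Matrix (Fin d) (Fin d) ℚ} (hB : IsDigitMatrices b B) (a : Fin k) (m : ℕ) :
    basisVec b (k * m + a) = toComplex (B a) *ᵥ basisVec b m := by
  ext i
  simp [basisVec, hB a m i, Matrix.mulVec, dotProduct, toComplex]

theorem toComplex_sum (B : Fin k → Matrix (Fin d) (Fin d) ℚ) :
    toComplex (∑ a, B a) = ∑ a, toComplex (B a) := by
  ext i j
  simp [toComplex, Matrix.sum_apply]

theorem coe_eq_sum_repr (b : Module.Basis (Fin d) ℚ (kernelSpace k f)) (g : kernelSpace k f)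
    (m : ℕ) : (g : ℕ → ℚ) m = ∑ i, b.repr g i * (b i : ℕ → ℚ) m := by
  have h := congrArg (fun h : kernelSpace k f => (h : ℕ → ℚ) m) (b.sum_repr g)
  simp only [Submodule.coe_sum, Submodule.coe_smul, Finset.sum_apply, Pi.smul_apply,
    smul_eq_mul] at h
  exact h.symm

/-- A functional vanishing on all these vectors would be a linear relation among the basis
sequences. The argument runs over `ℚ`, where independence is known, and passes to `ℂ` through the
standard basis vectors. -/
theorem span_range_basisVec (b : Module.Basis (Fin d) ℚ (kernelSpace k f)) :
    Submodule.span ℂ (Set.range (basisVec b)) = ⊤ := by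
  have hQ : Submodule.span ℚ (Set.range fun m : ℕ => fun i => (b i : ℕ → ℚ) m) = ⊤ := by
    by_contra hne
    obtain ⟨φ, hφ, hle⟩ := Submodule.exists_le_ker_of_lt_top _ (lt_top_iff_ne_top.2 hne)
    have hsum : ∑ i, φ (Pi.single i 1) • b i = 0 := by
      ext m
      have h0 : φ (fun i => (b i : ℕ → ℚ) m) = 0 := hle (Submodule.subset_span ⟨m, rfl⟩)
      rw [LinearMap.pi_apply_eq_sum_univ φ] at h0
      simp only [Submodule.coe_sum, Submodule.coe_smul, Finset.sum_apply, Pi.smul_apply,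
        Submodule.coe_zero, Pi.zero_apply]
      rw [← h0]
      refine Finset.sum_congr rfl fun i _ => ?_
      rw [smul_eq_mul, smul_eq_mul, mul_comm]
      congr 2
      ext j
      simp [Pi.single_apply, eq_comm]
    have h1 := Fintype.linearIndependent_iff.1 b.linearIndependent _ hsum
    refine hφ (LinearMap.pi_ext' fun i => LinearMap.ext_ring ?_)
    simpa using h1 i
  rw [eq_top_iff, ← (Pi.basisFun ℂ (Fin d)).span_eq, Submodule.span_le]
  rintro _ ⟨i, rfl⟩
  have key : ∀ x ∈ Submodule.span ℚ (Set.range fun m : ℕ => fun i => (b i : ℕ → ℚ) m),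
      (fun i => ((x i : ℚ) : ℂ)) ∈ Submodule.span ℂ (Set.range (basisVec b)) := by
    intro x hx
    induction hx using Submodule.span_induction with
    | mem x hx =>
      obtain ⟨m, rfl⟩ := hx
      exact Submodule.subset_span ⟨m, rfl⟩
    | zero =>
      convert Submodule.zero_mem _ using 1
      ext; simp
    | add x y _ _ hx hy =>
      convert Submodule.add_mem _ hx hy using 1
      ext; simp
    | smul c x _ hx =>
      convert Submodule.smul_mem _ (c : ℂ) hx using 1
      ext; simp
  have h : Pi.basisFun ℂ (Fin d) i = fun j => (((Pi.single i 1 : Fin d → ℚ) j : ℚ) : ℂ) := by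
    ext j
    simp [Pi.single_apply, apply_ite]
  rw [SetLike.mem_coe, h]
  exact key _ (hQ ▸ trivial)

theorem exists_dual_basisVec (b : Module.Basis (Fin d) ℚ (kernelSpace k f)) :
    ∃ e : (Fin d → ℂ) →ₗ[ℂ] ℂ, ∀ m, e (basisVec b m) = f m := by
  refine ⟨∑ i, ((b.repr ⟨_, mem_kernelSpace k f⟩ i : ℚ) : ℂ) • LinearMap.proj i, fun m => ?_⟩
  have h := coe_eq_sum_repr b ⟨_, mem_kernelSpace k f⟩ m
  have h' := congrArg (fun x : ℚ => (x : ℂ)) h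
  simp only [Rat.cast_intCast, Rat.cast_sum, Rat.cast_mul] at h'
  rw [h']
  simp [LinearMap.sum_apply, basisVec]

/-- Positive integers are at least `1`, so `f (k ^ n)` cannot decay, whereas it is `O(q ^ n)` for
some `q < ρ`. -/
theorem one_lt_of_jointSpecRadius_lt (hk : 2 ≤ k) (hf : ∀ m : ℕ, 1 ≤ m → 0 < f m)
    {b : Module.Basis (Fin d) ℚ (kernelSpace k f)}
    {B : Fin k → Matrix (Fin d) (Fin d) ℚ} (hB : IsDigitMatrices b B) {ρ : ℝ}
    (hρ : jointSpecRadius (fun a => toComplex (B a)) < ρ) : 1 < ρ := by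
  have : NeZero k := ⟨by omega⟩
  obtain ⟨q, hq, hqρ⟩ := exists_between hρ
  have hq0 : 0 < q := (jointSpecRadius_nonneg _).trans_lt hq
  obtain ⟨C, hC, H⟩ := exists_norm_le_of_jointSpecRadius_lt (basisVec_mul_add hB) hq
  obtain ⟨e, he⟩ := exists_dual_basisVec b
  by_contra! hle
  have ht := ((tendsto_pow_atTop_nhds_zero_of_lt_one hq0.le (hqρ.trans_le hle)).const_mul
    (‖LinearMap.toContinuousLinearMap e‖ * C))
  rw [mul_zero] at ht
  obtain ⟨n, hn⟩ := (ht.eventually_lt_const one_pos).exists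
  have h1 : k ^ n < k ^ (n + 1) := Nat.pow_lt_pow_right (by omega) n.lt_succ_self
  have h2 := (LinearMap.toContinuousLinearMap e).le_opNorm (basisVec b (k ^ n))
  rw [LinearMap.coe_toContinuousLinearMap', he, Complex.norm_intCast] at h2
  have h3 : (1 : ℝ) ≤ |(f (k ^ n) : ℝ)| := by
    have : (1 : ℤ) ≤ f (k ^ n) := hf _ (Nat.one_le_pow _ _ (by omega))
    exact le_trans (by exact_mod_cast this) (le_abs_self _)
  have h4 := mul_le_mul_of_nonneg_left (H n (k ^ n) le_rfl h1)
    (norm_nonneg (LinearMap.toContinuousLinearMap e))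
  linarith

/-- Each value of `g` is one of the non-negative terms of a longer block sum of `f`, so domination
carries estimates from `f` to its kernel. -/
theorem blockSum_kernel_le (hf : ∀ m, 0 ≤ f m) {g : ℕ → ℚ} {ℓ r : ℕ} (hr : r < k ^ ℓ)
    (hg : ∀ n, g n = (f (k ^ ℓ * n + r) : ℚ)) (M n : ℕ) :
    0 ≤ blockSum k g M n ∧ blockSum k g M n ≤ (blockSum k f M (n + ℓ) : ℤ) := by
  refine ⟨Finset.sum_nonneg fun m _ => by rw [hg]; exact_mod_cast hf _, ?_⟩
  rw [add_comm, blockSum_add, blockSum, blockSum, Int.cast_sum]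
  refine Finset.sum_le_sum fun m _ => ?_
  rw [hg]
  norm_cast
  refine Finset.single_le_sum (fun i _ => hf i) (Finset.mem_Ico.2 ⟨by omega, ?_⟩)
  rw [mul_add]
  omega

theorem blockSum_nonneg (hf : ∀ m, 0 ≤ f m) (M n : ℕ) : 0 ≤ blockSum k f M n :=
  Finset.sum_nonneg fun m _ => hf m

theorem blockSum_le_regionSum (hk : 2 ≤ k) (hf : ∀ m, 0 ≤ f m) {M ℓ : ℕ} (h1 : k ^ ℓ ≤ M)
    (h2 : M < k ^ (ℓ + 1)) (n : ℕ) : blockSum k f M n ≤ regionSum k f (n + ℓ) := by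
  rw [regionSum, sum_region_eq hk]
  exact Finset.single_le_sum (f := fun M => blockSum k f M n)
    (fun M _ => blockSum_nonneg hf M n) (Finset.mem_Ico.2 ⟨h1, h2⟩)

end

theorem tendsto_re_of_tendsto_normalized_pow {V : Type*} [NormedAddCommGroup V]
    [NormedSpace ℂ V] [FiniteDimensional ℂ V] {T : Module.End ℂ V} {ρ : ℝ} {j : ℕ} {P : V →ₗ[ℂ] V}
    (hP : ∀ u, Tendsto (fun n : ℕ => ((n : ℂ) ^ j * (ρ : ℂ) ^ n)⁻¹ • (T ^ n) u) atTop (𝓝 (P u)))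
    (e : V →ₗ[ℂ] ℂ) {u : V} {s : ℕ → ℝ} (hs : ∀ n, e ((T ^ n) u) = s n) :
    Tendsto (fun n : ℕ => s n / ((n : ℝ) ^ j * ρ ^ n)) atTop (𝓝 (e (P u)).re) := by
  have h1 := (e.continuous_of_finiteDimensional.tendsto _).comp (hP u)
  have h2 : Tendsto (fun n : ℕ => ((s n / ((n : ℝ) ^ j * ρ ^ n) : ℝ) : ℂ)) atTop
      (𝓝 (e (P u))) := by
    refine h1.congr fun n => ?_
    rw [Function.comp_apply, map_smul, hs, smul_eq_mul]
    push_cast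
    rw [div_eq_inv_mul]
  have h3 := (Complex.continuous_re.tendsto _).comp h2
  exact h3.congr fun n => Complex.ofReal_re _

/-- The normalised sums of a positive regular sequence over the blocks of integers with a given
initial string of digits converge, with limits controlled by the joint spectral radius. -/
theorem exists_tendsto_blockSum_div_regionSum {k d : ℕ} {f : ℕ → ℤ} (hk : 2 ≤ k) (hf0 : 0 ≤ f 0)
    (hf : ∀ m : ℕ, 1 ≤ m → 0 < f m) {b : Module.Basis (Fin d) ℚ (kernelSpace k f)}
    {B : Fin k → Matrix (Fin d) (Fin d) ℚ} (hB : IsDigitMatrices b B) {ρ : ℝ}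
    (hρ : ρ = specRadius (toComplex (∑ a, B a)))
    (hdom : SpecRadiusUniqueDominant (toComplex (∑ a, B a)))
    (hlt : jointSpecRadius (fun a => toComplex (B a)) < ρ) :
    ∃ W : ℕ → ℝ,
      (∀ ℓ M, Tendsto (fun n => ((blockSum k f M n : ℤ) : ℝ) / (regionSum k f (n + ℓ) : ℝ)) atTop
        (𝓝 (W M / ρ ^ ℓ))) ∧
      ∀ q, jointSpecRadius (fun a => toComplex (B a)) < q → ∃ C, 0 < C ∧ ∀ ℓ M,
        k ^ ℓ ≤ M → M < k ^ (ℓ + 1) → W M ≤ C * q ^ ℓ := by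
  have : NeZero k := ⟨by omega⟩
  have hf' : ∀ m, 0 ≤ f m := fun m => by
    rcases Nat.eq_zero_or_pos m with rfl | h
    · exact hf0
    · exact (hf m h).le
  have h1ρ : 1 < ρ := one_lt_of_jointSpecRadius_lt hk hf hB hlt
  have hρ0 : 0 < ρ := one_pos.trans h1ρ
  set T : Module.End ℂ (Fin d → ℂ) := Matrix.toLin' (∑ a, toComplex (B a)) with hT
  have hspec : ∀ z, T.HasEigenvalue z ↔ z ∈ spectrum ℂ (toComplex (∑ a, B a)) := fun z => by
    rw [Module.End.hasEigenvalue_iff_mem_spectrum, hT, Matrix.spectrum_toLin', toComplex_sum]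
  obtain ⟨j, P, hP0, hP⟩ := Module.End.exists_tendsto_normalized_pow T hρ0
    ((hspec _).2 (hρ ▸ hdom.1)) (fun z hz hne => by
      rw [hρ] at hne ⊢
      exact hdom.2 z ((hspec z).1 hz) hne)
  have hPT : ∀ u, P (T u) = (ρ : ℂ) • P u :=
    Module.End.comp_eq_smul_of_tendsto_normalized_pow hρ0 hP
  have hPTn : ∀ (n : ℕ) u, P ((T ^ n) u) = ((ρ : ℂ) ^ n) • P u := by
    intro n u
    induction n with
    | zero => simp
    | succ n ih => rw [pow_succ', Module.End.mul_apply, hPT, ih, smul_smul, ← pow_succ']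
  obtain ⟨e, he⟩ := exists_dual_basisVec b
  set V := basisVec b with hVdef
  have hV : ∀ (a : Fin k) m, V (k * m + a) = toComplex (B a) *ᵥ V m := basisVec_mul_add hB
  have heb : ∀ M n, e ((T ^ n) (V M)) = (((blockSum k f M n : ℤ) : ℝ) : ℂ) := by
    intro M n
    rw [hT, pow_apply_eq_blockSum hV, map_blockSum]
    simp only [he, blockSum]
    push_cast
    rfl
  -- Summing over the non-zero leading digits makes `e (T ^ n v)` the total over the fundamental
  -- region.
  set v := ∑ a ∈ Finset.Ico 1 k, V a with hv
  have hev : ∀ n, e ((T ^ n) v) = (((regionSum k f n : ℤ) : ℝ) : ℂ) := by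
    intro n
    have := sum_region_eq hk f n 0
    simp only [add_zero, pow_zero, zero_add, pow_one] at this
    rw [hv, map_sum, map_sum, regionSum, this]
    simp only [heb]
    push_cast
    rfl
  have hev' : ∀ ℓ n, e ((T ^ n) ((T ^ ℓ) v)) = (((regionSum k f (n + ℓ) : ℤ) : ℝ) : ℂ) := by
    intro ℓ n
    rw [← hev, pow_add, Module.End.mul_apply]
  have heb' : ∀ ℓ M n, e ((T ^ n) ((T ^ ℓ) (V M))) =
      (((blockSum k f M (n + ℓ) : ℤ) : ℝ) : ℂ) := by
    intro ℓ M n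
    rw [← heb, pow_add, Module.End.mul_apply]
  have hc : ∀ᶠ n : ℕ in atTop, 0 < (n : ℝ) ^ j * ρ ^ n := by
    filter_upwards [eventually_ge_atTop 1] with n hn
    positivity
  have hr0 : ∀ n, (0 : ℝ) ≤ regionSum k f n := fun n => by
    exact_mod_cast Finset.sum_nonneg fun m _ => hf' m
  have hκ := tendsto_re_of_tendsto_normalized_pow hP e hev
  set κ := (e (P v)).re with hκdef
  have hre : ∀ ℓ u, (e (P ((T ^ ℓ) u))).re = ρ ^ ℓ * (e (P u)).re := by
    intro ℓ u
    rw [hPTn, map_smul, smul_eq_mul, ← Complex.ofReal_pow, Complex.re_ofReal_mul]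
  -- A priori `e ∘ P` could vanish at `v` although `P ≠ 0`; positivity of `f` and the spanning
  -- property exclude this.
  have hκ0 : κ ≠ 0 := by
    intro h0
    have hL : ∀ M, 1 ≤ M → (e (P (V M))).re = 0 := by
      intro M hM
      have h1 := tendsto_re_of_tendsto_normalized_pow hP e (heb M)
      have h2 := tendsto_re_of_tendsto_normalized_pow hP e (hev' (Nat.log k M))
      rw [hre, ← hκdef, h0, mul_zero] at h2
      refine tendsto_nhds_unique h1 (squeeze_zero' ?_ ?_ h2)
      · filter_upwards [hc] with n hn
        exact div_nonneg (by exact_mod_cast blockSum_nonneg hf' M n) hn.le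
      · filter_upwards [hc] with n hn
        refine div_le_div_of_nonneg_right ?_ hn.le
        exact_mod_cast blockSum_le_regionSum hk hf' (Nat.pow_log_le_self k (by omega))
          (Nat.lt_pow_succ_log_self (by omega) M) n
    -- The claim is linear in `g`, so it suffices to treat the kernel, where block sums of `f`
    -- dominate.
    have hker : ∀ g ∈ kernelSpace k f, ∀ M, 1 ≤ M →
        Tendsto (fun n : ℕ => ((blockSum k g M n : ℚ) : ℝ) / ((n : ℝ) ^ j * ρ ^ n)) atTop (𝓝 0) := by
      intro g hg M hM
      induction hg using Submodule.span_induction with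
      | mem g hg =>
        obtain ⟨ℓ, r, hr, hg⟩ := hg
        have h1 := tendsto_re_of_tendsto_normalized_pow hP e (heb' ℓ M)
        rw [hre, hL M hM, mul_zero] at h1
        refine squeeze_zero' ?_ ?_ h1
        · filter_upwards [hc] with n hn
          exact div_nonneg (by exact_mod_cast (blockSum_kernel_le hf' hr hg M n).1) hn.le
        · filter_upwards [hc] with n hn
          refine div_le_div_of_nonneg_right ?_ hn.le
          exact_mod_cast (blockSum_kernel_le hf' hr hg M n).2
      | zero => simp [blockSum]
      | add x y _ _ hx hy =>
        have := hx.add hy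
        rw [add_zero] at this
        refine this.congr fun n => ?_
        simp only [blockSum, Pi.add_apply, Finset.sum_add_distrib]
        push_cast
        ring
      | smul c x _ hx =>
        have := hx.const_mul (c : ℝ)
        rw [mul_zero] at this
        refine this.congr fun n => ?_
        simp only [blockSum, Pi.smul_apply, smul_eq_mul, ← Finset.mul_sum]
        push_cast
        ring
    have hPV : ∀ M, 1 ≤ M → P (V M) = 0 := by
      intro M hM
      ext i
      have h1 := (hker _ (b i).2 M hM).ofReal
      refine tendsto_nhds_unique (((continuous_apply i).tendsto _).comp (hP (V M)))
        (h1.congr fun n => ?_)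
      rw [Function.comp_apply, hT, pow_apply_eq_blockSum hV, Pi.smul_apply, smul_eq_mul,
        div_eq_inv_mul]
      simp only [blockSum, Finset.sum_apply, hVdef, basisVec]
      push_cast
      rfl
    -- The prefix `0` lies in no fundamental region, so domination does not reach it. Instead `T (V
    -- 0) = V 0 + v` gives `(1 - ρ) P (V 0) = 0`, and `ρ > 1`.
    have hPV0 : P (V 0) = 0 := by
      have h1 : T (V 0) = V 0 + v := by
        have := pow_apply_eq_blockSum hV 0 1
        rw [pow_one, ← hT] at this
        rw [this, hv, blockSum]
        simp only [mul_zero, pow_one, zero_add, mul_one]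
        rw [Finset.sum_eq_sum_Ico_succ_bot (by omega : 0 < k)]
      have h2 := hPT (V 0)
      have h3 : P v = 0 := by
        rw [hv, map_sum]
        exact Finset.sum_eq_zero fun a ha => hPV a (Finset.mem_Ico.1 ha).1
      rw [h1, map_add, h3, add_zero, ← sub_eq_zero] at h2
      have h4 : (1 - (ρ : ℂ)) • P (V 0) = 0 := by rw [sub_smul, one_smul, h2]
      refine (smul_eq_zero.1 h4).resolve_left ?_
      refine sub_ne_zero.2 ?_
      exact_mod_cast h1ρ.ne
    refine hP0 (LinearMap.ext_on_range (span_range_basisVec b) fun M => ?_)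
    rcases Nat.eq_zero_or_pos M with rfl | hM
    · exact hPV0
    · exact hPV M hM
  have hκpos : 0 < κ := by
    refine lt_of_le_of_ne (ge_of_tendsto hκ ?_) hκ0.symm
    filter_upwards [hc] with n hn
    exact div_nonneg (hr0 n) hn.le
  -- The total at level `n + ℓ`, normalised at level `n`, tends to `ρ ^ ℓ κ`; hence the factor `ρ ^
  -- ℓ` in the limit.
  refine ⟨fun M => (e (P (V M))).re / κ, fun ℓ M => ?_, fun q hq => ?_⟩
  · have h1 := tendsto_re_of_tendsto_normalized_pow hP e (heb M)
    have h2 := tendsto_re_of_tendsto_normalized_pow hP e (hev' ℓ)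
    rw [hre] at h2
    have h3 := h1.div h2 (mul_ne_zero (pow_ne_zero _ hρ0.ne') hκ0)
    rw [div_div, mul_comm κ]
    refine h3.congr' ?_
    filter_upwards [hc] with n hn
    rw [Pi.div_apply, div_div_div_cancel_right₀ hn.ne']
  · have hq0 : 0 < q := (jointSpecRadius_nonneg _).trans_lt hq
    obtain ⟨C, hC, H⟩ := exists_norm_le_of_jointSpecRadius_lt hV hq
    set φ := LinearMap.toContinuousLinearMap (e ∘ₗ P) with hφ
    refine ⟨(‖φ‖ + 1) * C / κ, by positivity, fun ℓ M h1 h2 => ?_⟩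
    have h3 := φ.le_opNorm (V M)
    have h4 : (e (P (V M))).re ≤ ‖φ (V M)‖ := Complex.re_le_norm _
    have h5 : ‖φ‖ * ‖V M‖ ≤ (‖φ‖ + 1) * (C * q ^ ℓ) :=
      mul_le_mul (by linarith) (H ℓ M h1 h2) (norm_nonneg _) (by positivity)
    rw [div_mul_eq_mul_div, div_le_div_iff_of_pos_right hκpos]
    linarith

end RegularSeq

/-! ### The approximating measures and their weak convergence. -/

namespace RegularSeq

/-- The position in `[0, 1)` of the integer `m` of the fundamental region `[k ^ n, k ^ (n + 1))`. -/
noncomputable def position (k n m : ℕ) : ℝ :=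
  ((m : ℝ) - (k : ℝ) ^ n) / ((k : ℝ) ^ n * ((k : ℝ) - 1))

/-- Integers with prefix `M` are placed in one half-open cell that does not depend on `n`, so masses
at different stages can be compared cell by cell. -/
theorem position_mem_Ico {k : ℕ} (hk : 2 ≤ k) {n ℓ M m : ℕ}
    (hm : m ∈ Finset.Ico (k ^ n * M) (k ^ n * (M + 1))) :
    position k (n + ℓ) m ∈
      Set.Ico (position k ℓ M) (position k ℓ M + 1 / ((k : ℝ) ^ ℓ * ((k : ℝ) - 1))) := by
  have hk' : (2 : ℝ) ≤ k := by exact_mod_cast hk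
  have hk1 : (0 : ℝ) < k - 1 := by linarith
  have hn : (0 : ℝ) < (k : ℝ) ^ n := by positivity
  have hl : (0 : ℝ) < (k : ℝ) ^ ℓ * (k - 1) := by positivity
  obtain ⟨h1, h2⟩ := Finset.mem_Ico.1 hm
  have h1' : (k : ℝ) ^ n * M ≤ m := by exact_mod_cast h1
  have h2' : (m : ℝ) < (k : ℝ) ^ n * (M + 1) := by exact_mod_cast h2
  have e : position k (n + ℓ) m =
      (((m : ℝ) - (k : ℝ) ^ n * k ^ ℓ) / (k : ℝ) ^ n) / ((k : ℝ) ^ ℓ * (k - 1)) := by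
    rw [position, pow_add, div_div, mul_assoc]
  rw [e, position, ← add_div, Set.mem_Ico, div_le_div_iff_of_pos_right hl,
    div_lt_div_iff_of_pos_right hl, le_div_iff₀ hn, div_lt_iff₀ hn]
  constructor <;> nlinarith

section
variable {k : ℕ} {f : ℕ → ℤ}

theorem regionSum_pos (hk : 2 ≤ k) (hf : ∀ m : ℕ, 1 ≤ m → 0 < f m) (n : ℕ) :
    0 < regionSum k f n := by
  refine Finset.sum_pos (fun m hm => hf m ?_) ?_
  · exact (Nat.one_le_pow _ _ (by omega)).trans (Finset.mem_Ico.1 hm).1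
  · rw [Finset.nonempty_Ico]
    exact Nat.pow_lt_pow_right (by omega) n.lt_succ_self

theorem isProbabilityMeasure_approxMeasure (hk : 2 ≤ k) (hf : ∀ m : ℕ, 1 ≤ m → 0 < f m) (n : ℕ) :
    IsProbabilityMeasure (approxMeasure k f n) := by
  have hS : (0 : ℝ) < regionSum k f n := by exact_mod_cast regionSum_pos hk hf n
  refine ⟨?_⟩
  simp only [approxMeasure, Measure.smul_apply, Measure.finsetSum_apply, measure_univ, smul_eq_mul,
    mul_one]
  have e : ∑ m ∈ Finset.range (k ^ (n + 1) - k ^ n), ENNReal.ofReal (f (k ^ n + m) : ℝ) =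
      ENNReal.ofReal (regionSum k f n : ℝ) := by
    rw [regionSum, Finset.sum_Ico_eq_sum_range, Int.cast_sum, ENNReal.ofReal_sum_of_nonneg]
    intro m _
    exact_mod_cast (hf _ (by have := Nat.one_le_pow n k (by omega); omega)).le
  rw [e]
  exact ENNReal.inv_mul_cancel (by simpa using hS) ENNReal.ofReal_ne_top

theorem integral_approxMeasure (hk : 2 ≤ k) (hf : ∀ m : ℕ, 1 ≤ m → 0 < f m) (n : ℕ)
    (g : UnitAddCircle → ℝ) :
    ∫ x, g x ∂(approxMeasure k f n) = (∑ m ∈ Finset.Ico (k ^ n) (k ^ (n + 1)),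
      (f m : ℝ) * g ((position k n m : ℝ) : UnitAddCircle)) / regionSum k f n := by
  have hS : (0 : ℝ) < regionSum k f n := by exact_mod_cast regionSum_pos hk hf n
  rw [approxMeasure, integral_smul_measure, integral_finsetSum_measure]
  · rw [ENNReal.toReal_inv, ENNReal.toReal_ofReal hS.le, smul_eq_mul, div_eq_inv_mul,
      Finset.sum_Ico_eq_sum_range]
    congr 1
    refine Finset.sum_congr rfl fun m _ => ?_
    have : (0 : ℝ) ≤ f (k ^ n + m) := by
      exact_mod_cast (hf _ (by have := Nat.one_le_pow n k (by omega); omega)).le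
    rw [integral_smul_measure, integral_dirac, ENNReal.toReal_ofReal this, smul_eq_mul, position]
    push_cast
    rw [add_sub_cancel_left]
  · intro m _
    refine Integrable.smul_measure ?_ ENNReal.ofReal_ne_top
    exact integrable_dirac (by simp)

theorem integral_approxMeasure_add (hk : 2 ≤ k) (hf : ∀ m : ℕ, 1 ≤ m → 0 < f m) (n ℓ : ℕ)
    (g : UnitAddCircle → ℝ) :
    ∫ x, g x ∂(approxMeasure k f (n + ℓ)) = (∑ M ∈ Finset.Ico (k ^ ℓ) (k ^ (ℓ + 1)),
      blockSum k (fun m => (f m : ℝ) * g ((position k (n + ℓ) m : ℝ) : UnitAddCircle)) M n) /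
        regionSum k f (n + ℓ) := by
  rw [integral_approxMeasure hk hf, sum_region_eq hk]

theorem dist_coe_le (s t : ℝ) : dist (s : UnitAddCircle) (t : UnitAddCircle) ≤ |s - t| := by
  rw [dist_eq_norm, ← AddCircle.coe_sub, UnitAddCircle.norm_eq]
  simpa using round_le (s - t) 0

theorem regionSum_add_eq (hk : 2 ≤ k) (n ℓ : ℕ) : (regionSum k f (n + ℓ) : ℝ) =
    ∑ M ∈ Finset.Ico (k ^ ℓ) (k ^ (ℓ + 1)), ((blockSum k f M n : ℤ) : ℝ) := by
  rw [regionSum, sum_region_eq hk, Int.cast_sum]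

/-- Freezing `g` at the left end of each cell costs at most `ε`, uniformly in `n`, since the weights
sum to one. -/
theorem abs_integral_sub_le (hk : 2 ≤ k) (hf : ∀ m : ℕ, 1 ≤ m → 0 < f m) {ℓ : ℕ}
    {g : UnitAddCircle → ℝ} {ε δ : ℝ}
    (hg : ∀ x y, dist x y < δ → |g x - g y| ≤ ε) (hℓ : 1 / ((k : ℝ) ^ ℓ * ((k : ℝ) - 1)) < δ)
    (n : ℕ) :
    |∫ x, g x ∂(approxMeasure k f (n + ℓ)) - ∑ M ∈ Finset.Ico (k ^ ℓ) (k ^ (ℓ + 1)),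
      g ((position k ℓ M : ℝ) : UnitAddCircle) *
        (((blockSum k f M n : ℤ) : ℝ) / regionSum k f (n + ℓ))| ≤ ε := by
  have hS : (0 : ℝ) < regionSum k f (n + ℓ) := by exact_mod_cast regionSum_pos hk hf _
  rw [integral_approxMeasure_add hk hf]
  simp only [← mul_div_assoc]
  rw [← Finset.sum_div, ← sub_div, ← Finset.sum_sub_distrib, abs_div, abs_of_pos hS,
    div_le_iff₀ hS, regionSum_add_eq hk, Finset.mul_sum]
  refine (Finset.abs_sum_le_sum_abs _ _).trans (Finset.sum_le_sum fun M hM => ?_)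
  rw [blockSum, blockSum, Int.cast_sum, Finset.mul_sum, Finset.mul_sum, ← Finset.sum_sub_distrib]
  refine (Finset.abs_sum_le_sum_abs _ _).trans (Finset.sum_le_sum fun m hm => ?_)
  have hM1 : 1 ≤ M := (Nat.one_le_pow _ _ (by omega)).trans (Finset.mem_Ico.1 hM).1
  have hm1 : 1 ≤ m := (Nat.mul_pos (Nat.pow_pos (by omega : 0 < k)) hM1).trans_le (Finset.mem_Ico.1 hm).1
  have hfm : (0 : ℝ) ≤ f m := by exact_mod_cast (hf m hm1).le
  obtain ⟨h1, h2⟩ := position_mem_Ico (ℓ := ℓ) hk hm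
  rw [mul_comm (f m : ℝ), ← sub_mul, abs_mul, abs_of_nonneg hfm]
  refine mul_le_mul_of_nonneg_right (hg _ _ ((dist_coe_le _ _).trans_lt ?_)) hfm
  rw [abs_of_nonneg (by linarith)]
  linarith

theorem exists_lt_one_div_pow (hk : 2 ≤ k) {δ : ℝ} (hδ : 0 < δ) :
    ∃ ℓ : ℕ, 1 / ((k : ℝ) ^ ℓ * ((k : ℝ) - 1)) < δ := by
  have hk' : (2 : ℝ) ≤ k := by exact_mod_cast hk
  obtain ⟨ℓ, hℓ⟩ := exists_pow_lt_of_lt_one hδ (y := 1 / (k : ℝ)) (by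
    rw [div_lt_one (by linarith)]; linarith)
  refine ⟨ℓ, lt_of_le_of_lt ?_ hℓ⟩
  rw [one_div_pow]
  exact one_div_le_one_div_of_le (by positivity)
    (le_mul_of_one_le_right (by positivity) (by linarith))

theorem cauchySeq_integral_approxMeasure (hk : 2 ≤ k) (hf : ∀ m : ℕ, 1 ≤ m → 0 < f m)
    (hlim : ∀ ℓ M, ∃ w : ℝ, Tendsto
      (fun n => ((blockSum k f M n : ℤ) : ℝ) / (regionSum k f (n + ℓ) : ℝ)) atTop (𝓝 w))
    (g : C(UnitAddCircle, ℝ)) :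
    CauchySeq fun n => ∫ x, g x ∂(approxMeasure k f n) := by
  choose w hw using hlim
  rw [Metric.cauchySeq_iff']
  intro ε hε
  obtain ⟨δ, hδ, hg⟩ := Metric.uniformContinuous_iff.1
    (CompactSpace.uniformContinuous_of_continuous g.continuous) (ε / 8) (by positivity)
  obtain ⟨ℓ, hℓ⟩ := exists_lt_one_div_pow hk hδ
  have h1 := abs_integral_sub_le hk hf (ε := ε / 8) (g := g)
    (fun x y hxy => by
      have := hg hxy
      rw [Real.dist_eq] at this
      exact this.le) hℓ
  have h2 : Tendsto (fun n => ∑ M ∈ Finset.Ico (k ^ ℓ) (k ^ (ℓ + 1)),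
      g ((position k ℓ M : ℝ) : UnitAddCircle) *
        (((blockSum k f M n : ℤ) : ℝ) / regionSum k f (n + ℓ))) atTop
      (𝓝 (∑ M ∈ Finset.Ico (k ^ ℓ) (k ^ (ℓ + 1)),
        g ((position k ℓ M : ℝ) : UnitAddCircle) * w ℓ M)) :=
    tendsto_finsetSum _ fun M _ => (hw ℓ M).const_mul _
  obtain ⟨N, hN⟩ := Metric.tendsto_atTop.1 h2 (ε / 8) (by positivity)
  refine ⟨N + ℓ, fun n hn => ?_⟩
  obtain ⟨n, rfl⟩ := Nat.exists_eq_add_of_le' (show ℓ ≤ n by omega)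
  have a1 := h1 n
  have a2 := h1 N
  have a3 := hN n (by omega)
  have a4 := hN N le_rfl
  rw [Real.dist_eq] at a3 a4 ⊢
  rw [abs_lt] at a3 a4 ⊢
  rw [abs_le] at a1 a2
  constructor <;> linarith [a1.1, a1.2, a2.1, a2.2, a3.1, a3.2, a4.1, a4.2]

end

/-- Compactness of the space of probability measures gives a limit along an ultrafilter; as all
integrals converge, it is the limit of the whole sequence. -/
theorem exists_tendsto_of_cauchySeq_integral {X : Type*} [TopologicalSpace X] [CompactSpace X]
    [T2Space X] [MeasurableSpace X] [BorelSpace X] (ν : ℕ → ProbabilityMeasure X)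
    (h : ∀ g : C(X, ℝ), CauchySeq fun n => ∫ x, g x ∂(ν n : Measure X)) :
    ∃ μ : ProbabilityMeasure X, Tendsto ν atTop (𝓝 μ) := by
  set U : Ultrafilter ℕ := Ultrafilter.of atTop with hU
  obtain ⟨μ, -, hμ⟩ := isCompact_univ.ultrafilter_le_nhds (U.map ν) (by simp)
  refine ⟨μ, ProbabilityMeasure.tendsto_iff_forall_integral_tendsto.2 fun g => ?_⟩
  obtain ⟨y, hy⟩ := cauchySeq_tendsto_of_complete (h g.toContinuousMap)
  have h1 := ProbabilityMeasure.tendsto_iff_forall_integral_tendsto.1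
    (show Tendsto ν U (𝓝 μ) from hμ) g
  have h2 : y = ∫ x, g x ∂(μ : Measure X) :=
    tendsto_nhds_unique (hy.mono_left (Ultrafilter.of_le atTop)) h1
  rw [← h2]
  exact hy

/-! ### Counting the cells that meet a ball. -/

section
variable {k : ℕ} {f : ℕ → ℤ}

/-- The cells of level `ℓ` that meet a given ball. -/
theorem exists_finset_of_mem_ball (hk : 2 ≤ k) (x : UnitAddCircle) {r : ℝ} (hr : 0 < r) (ℓ : ℕ) :
    ∃ J : Finset ℕ, (J.card : ℝ) ≤ 2 * ((k : ℝ) ^ ℓ * ((k : ℝ) - 1)) * r + 2 ∧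
      ∀ M ∈ Finset.Ico (k ^ ℓ) (k ^ (ℓ + 1)), ∀ p ∈
        Set.Ico (position k ℓ M) (position k ℓ M + 1 / ((k : ℝ) ^ ℓ * ((k : ℝ) - 1))),
        (p : UnitAddCircle) ∈ Metric.ball x r → M ∈ J := by
  have hk' : (2 : ℝ) ≤ k := by exact_mod_cast hk
  have hk1 : (0 : ℝ) < k - 1 := by linarith
  obtain ⟨t, rfl⟩ := QuotientAddGroup.mk_surjective x
  set K : ℕ := k ^ ℓ * (k - 1) with hK
  have hKr : (k : ℝ) ^ ℓ * ((k : ℝ) - 1) = K := by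
    rw [hK, Nat.cast_mul, Nat.cast_sub (by omega)]
    push_cast
    rfl
  have hK0 : (0 : ℝ) < K := by rw [← hKr]; positivity
  rw [hKr]
  -- The circle is divided into `K` cells of length `1 / K`; a lift `s` lies over the cell with
  -- index `⌊K * s⌋` modulo `K`, and numbering starts at `k ^ ℓ`.
  refine ⟨(Finset.Icc ⌊K * (t - r)⌋ ⌊K * (t + r)⌋).image fun i : ℤ => k ^ ℓ + (i % K).toNat,
    ?_, fun M hM p hp hpb => ?_⟩
  · have hc : ((Finset.Icc ⌊K * (t - r)⌋ ⌊K * (t + r)⌋).card : ℝ) ≤ 2 * K * r + 2 := by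
      have hle : ⌊K * (t - r)⌋ ≤ ⌊K * (t + r)⌋ := Int.floor_le_floor (by
        refine mul_le_mul_of_nonneg_left ?_ hK0.le
        linarith)
      have h0 : ((Finset.Icc ⌊K * (t - r)⌋ ⌊K * (t + r)⌋).card : ℤ) =
          ⌊K * (t + r)⌋ + 1 - ⌊K * (t - r)⌋ := by
        rw [Int.card_Icc, Int.toNat_of_nonneg (by omega)]
      have h1 : ((Finset.Icc ⌊K * (t - r)⌋ ⌊K * (t + r)⌋).card : ℝ) =
          ⌊K * (t + r)⌋ + 1 - ⌊K * (t - r)⌋ := by exact_mod_cast h0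
      rw [h1]
      have h2 := Int.floor_le (K * (t + r))
      have h3 := Int.lt_floor_add_one (K * (t - r))
      nlinarith
    exact (Nat.cast_le.2 Finset.card_image_le).trans hc
  · obtain ⟨s, hs, hsp⟩ := exists_mem_Ioo_of_mem_ball hpb
    obtain ⟨hM1, hM2⟩ := Finset.mem_Ico.1 hM
    obtain ⟨z, hz⟩ : ∃ z : ℤ, p = s + z := by
      have h0 : ((p - s : ℝ) : UnitAddCircle) = 0 := by
        rw [AddCircle.coe_sub, hsp, sub_self]
      obtain ⟨z, hz⟩ := (AddCircle.coe_eq_zero_iff (1 : ℝ)).1 h0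
      refine ⟨z, ?_⟩
      simp only [zsmul_eq_mul, mul_one] at hz
      linarith
    rw [position, hKr, Set.mem_Ico, ← add_div, div_le_iff₀ hK0, lt_div_iff₀ hK0] at hp
    have hfl : ⌊K * s⌋ = (M : ℤ) - k ^ ℓ - K * z := by
      rw [Int.floor_eq_iff]
      push_cast
      constructor <;> nlinarith [hp.1, hp.2]
    refine Finset.mem_image.2 ⟨⌊K * s⌋, Finset.mem_Icc.2 ⟨Int.floor_le_floor ?_,
      Int.floor_le_floor ?_⟩, ?_⟩
    · exact mul_le_mul_of_nonneg_left hs.1.le hK0.le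
    · exact mul_le_mul_of_nonneg_left hs.2.le hK0.le
    · have hMK : M - k ^ ℓ < K := by
        rw [hK, Nat.mul_sub, mul_one, ← pow_succ]
        omega
      have h4 : (M : ℤ) - k ^ ℓ = ((M - k ^ ℓ : ℕ) : ℤ) := by
        rw [Nat.cast_sub hM1]
        push_cast
        rfl
      rw [hfl, h4, Int.sub_mul_emod_self_left, Int.emod_eq_of_lt (by omega) (by exact_mod_cast hMK),
        Int.toNat_natCast]
      omega

theorem approxMeasure_ball_le (hk : 2 ≤ k) (hf : ∀ m : ℕ, 1 ≤ m → 0 < f m) {n ℓ : ℕ} {D : ℝ}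
    (hD0 : 0 ≤ D) (hD : ∀ M ∈ Finset.Ico (k ^ ℓ) (k ^ (ℓ + 1)),
      ((blockSum k f M n : ℤ) : ℝ) / (regionSum k f (n + ℓ) : ℝ) ≤ D)
    (x : UnitAddCircle) {r : ℝ} (hr : 0 < r) :
    (approxMeasure k f (n + ℓ)).real (Metric.ball x r) ≤
      (2 * ((k : ℝ) ^ ℓ * ((k : ℝ) - 1)) * r + 2) * D := by
  classical
  have hS : (0 : ℝ) < regionSum k f (n + ℓ) := by exact_mod_cast regionSum_pos hk hf _
  obtain ⟨J, hJ, H⟩ := exists_finset_of_mem_ball hk x hr ℓ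
  rw [← integral_indicator_one Metric.isOpen_ball.measurableSet, integral_approxMeasure_add hk hf,
    Finset.sum_div]
  have hle : ∀ M ∈ Finset.Ico (k ^ ℓ) (k ^ (ℓ + 1)),
      blockSum k (fun m => (f m : ℝ) *
        (Metric.ball x r).indicator 1 ((position k (n + ℓ) m : ℝ) : UnitAddCircle)) M n /
        regionSum k f (n + ℓ) ≤ if M ∈ J then D else 0 := by
    intro M hM
    have hM1 : 1 ≤ M := (Nat.one_le_pow _ _ (by omega)).trans (Finset.mem_Ico.1 hM).1
    have hfm : ∀ m ∈ Finset.Ico (k ^ n * M) (k ^ n * (M + 1)), (0 : ℝ) ≤ f m := fun m hm => by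
      have hm1 : 1 ≤ m :=
        (Nat.mul_pos (Nat.pow_pos (by omega : 0 < k)) hM1).trans_le (Finset.mem_Ico.1 hm).1
      exact_mod_cast (hf m hm1).le
    split_ifs with hMJ
    · refine le_trans (div_le_div_of_nonneg_right ?_ hS.le) (hD M hM)
      rw [blockSum, blockSum, Int.cast_sum]
      refine Finset.sum_le_sum fun m hm => mul_le_of_le_one_right (hfm m hm) ?_
      exact Set.indicator_le_self' (fun _ _ => zero_le_one) _
    · rw [blockSum, Finset.sum_eq_zero, zero_div]
      intro m hm
      rw [Set.indicator_of_notMem, mul_zero]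
      exact fun hb => hMJ (H M hM _ (position_mem_Ico hk hm) hb)
  refine (Finset.sum_le_sum hle).trans ?_
  rw [← Finset.sum_filter, Finset.sum_const, nsmul_eq_mul]
  refine mul_le_mul_of_nonneg_right (le_trans ?_ hJ) hD0
  exact_mod_cast Finset.card_le_card fun M hM => (Finset.mem_filter.1 hM).2

end

end RegularSeq

/-! ### Passage to the limit measure. -/

namespace RegularSeq

theorem measure_ball_le_rpow {k : ℕ} {f : ℕ → ℤ} (hk : 2 ≤ k) (hf : ∀ m : ℕ, 1 ≤ m → 0 < f m)
    {W : ℕ → ℝ} {ρ q C : ℝ} (hq : 0 < q) (hqρ : q < ρ) (hC : 0 < C)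
    (hW : ∀ ℓ M, Tendsto (fun n => ((blockSum k f M n : ℤ) : ℝ) / (regionSum k f (n + ℓ) : ℝ)) atTop
      (𝓝 (W M / ρ ^ ℓ)))
    (hWC : ∀ ℓ M, k ^ ℓ ≤ M → M < k ^ (ℓ + 1) → W M ≤ C * q ^ ℓ)
    {ν : ℕ → ProbabilityMeasure UnitAddCircle} (hν : ∀ n, (ν n : Measure _) = approxMeasure k f n)
    {μ : ProbabilityMeasure UnitAddCircle} (hμ : Tendsto ν atTop (𝓝 μ))
    (x : UnitAddCircle) {r : ℝ} (hr : 0 < r) (hr1 : r < 1) :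
    (μ : Measure UnitAddCircle) (Metric.ball x r) ≤
      ENNReal.ofReal (2 * k * (C + 1) * (k : ℝ) ^ Real.logb k (ρ / q) *
        r ^ Real.logb k (ρ / q)) := by
  set β := Real.logb k (ρ / q) with hβ
  have hk' : (2 : ℝ) ≤ k := by exact_mod_cast hk
  have hk0 : (0 : ℝ) < k := by linarith
  have hk1 : (1 : ℝ) < k := by linarith
  have hρ : 0 < ρ := hq.trans hqρ
  have hβ0 : 0 ≤ β := Real.logb_nonneg hk1 ((one_le_div hq).2 hqρ.le)
  have hkβ : (k : ℝ) ^ β = ρ / q := Real.rpow_logb hk0 hk1.ne' (by positivity)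
  -- With `k ^ (-(ℓ + 1)) < r ≤ k ^ (-ℓ)` the ball meets at most `2 k` cells of level `ℓ`.
  obtain ⟨ℓ, h1, h2⟩ := exists_nat_pow_near_of_lt_one hr hr1.le (y := (k : ℝ)⁻¹)
    (by positivity) (inv_lt_one_of_one_lt₀ hk1)
  -- Limiting cell masses are at most `C (q / ρ) ^ ℓ`; the extra `1` makes the bound strict, so it
  -- holds for all large `n`.
  set D : ℝ := (C + 1) * (q / ρ) ^ ℓ with hD
  have hD0 : 0 ≤ D := by positivity
  have hev : ∀ᶠ n in atTop, ∀ M ∈ Finset.Ico (k ^ ℓ) (k ^ (ℓ + 1)),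
      ((blockSum k f M n : ℤ) : ℝ) / (regionSum k f (n + ℓ) : ℝ) ≤ D := by
    rw [Filter.eventually_all_finset]
    intro M hM
    obtain ⟨hM1, hM2⟩ := Finset.mem_Ico.1 hM
    refine (hW ℓ M).eventually_le_const ?_
    have hpos : 0 < (q / ρ) ^ ℓ := by positivity
    have : W M / ρ ^ ℓ ≤ C * (q / ρ) ^ ℓ := by
      rw [div_pow, ← mul_div_assoc]
      exact div_le_div_of_nonneg_right (hWC ℓ M hM1 hM2) (by positivity)
    rw [hD]
    linarith
  have hball : ∀ᶠ n in atTop, (ν (n + ℓ) : Measure UnitAddCircle) (Metric.ball x r) ≤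
      ENNReal.ofReal (2 * k * D) := by
    filter_upwards [hev] with n hn
    rw [← ofReal_measureReal, hν]
    refine ENNReal.ofReal_le_ofReal ((approxMeasure_ball_le hk hf hD0 hn x hr).trans ?_)
    refine mul_le_mul_of_nonneg_right ?_ hD0
    have h3 : (k : ℝ) ^ ℓ * r ≤ 1 := by
      rw [inv_pow] at h2
      calc (k : ℝ) ^ ℓ * r ≤ (k : ℝ) ^ ℓ * ((k : ℝ) ^ ℓ)⁻¹ := by gcongr
        _ = 1 := mul_inv_cancel₀ (by positivity)
    nlinarith
  have hμ' : Tendsto (fun n => ν (n + ℓ)) atTop (𝓝 μ) := hμ.comp (tendsto_add_atTop_nat ℓ)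
  -- Portmanteau for open sets has the direction needed: the limit mass is at most the liminf.
  refine (ProbabilityMeasure.le_liminf_measure_open_of_tendsto hμ' Metric.isOpen_ball).trans ?_
  refine (liminf_le_of_frequently_le hball.frequently).trans (ENNReal.ofReal_le_ofReal ?_)
  have h4 : (q / ρ) ^ ℓ ≤ (k : ℝ) ^ β * r ^ β := by
    have h5 : q / ρ = ((k : ℝ)⁻¹) ^ β := by
      rw [Real.inv_rpow hk0.le, hkβ, inv_div]
    rw [h5, ← Real.rpow_natCast, ← Real.rpow_mul (by positivity), mul_comm β,
      Real.rpow_mul (by positivity), Real.rpow_natCast, ← Real.mul_rpow hk0.le hr.le]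
    refine Real.rpow_le_rpow (by positivity) ?_ hβ0
    calc (k : ℝ)⁻¹ ^ ℓ = k * (k : ℝ)⁻¹ ^ (ℓ + 1) := by
          rw [pow_succ']
          field_simp
      _ ≤ k * r := by gcongr
  calc 2 * k * D = 2 * k * (C + 1) * (q / ρ) ^ ℓ := by rw [hD]; ring
    _ ≤ 2 * k * (C + 1) * ((k : ℝ) ^ β * r ^ β) := by gcongr
    _ = _ := by ring

theorem measure_singleton_eq_zero_of_ball_le {X : Type*} [PseudoMetricSpace X] [MeasurableSpace X]
    {μ : Measure X} {C β : ℝ} (hβ : 0 < β) {x : X}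
    (h : ∀ r, 0 < r → r < 1 → μ (Metric.ball x r) ≤ ENNReal.ofReal (C * r ^ β)) : μ {x} = 0 := by
  have h1 : Tendsto (fun r : ℝ => ENNReal.ofReal (C * r ^ β)) (𝓝[>] 0) (𝓝 0) := by
    have h2 : Tendsto (fun r : ℝ => C * r ^ β) (𝓝[>] 0) (𝓝 (C * 0 ^ β)) :=
      ((Real.continuousAt_rpow_const 0 β (Or.inr hβ.le)).tendsto.const_mul C).mono_left
        nhdsWithin_le_nhds
    rw [Real.zero_rpow hβ.ne', mul_zero] at h2
    simpa using ENNReal.tendsto_ofReal h2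
  refine le_antisymm (ge_of_tendsto h1 ?_) zero_le
  filter_upwards [Ioo_mem_nhdsGT one_pos] with r hr
  exact (measure_mono (Set.singleton_subset_iff.2 (Metric.mem_ball_self hr.1))).trans
    (h r hr.1 hr.2)

/-- Growth bounds are available only for `q` strictly above the joint spectral radius; continuity of
the logarithm makes the loss arbitrarily small. -/
theorem exists_lt_logb_div (k : ℝ) {ρ ρs ε : ℝ} (hρs : 0 < ρs) (h : ρs < ρ) (hε : 0 < ε) :
    ∃ q, ρs < q ∧ q < ρ ∧ Real.logb k (ρ / ρs) - ε ≤ Real.logb k (ρ / q) := by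
  have hc : ContinuousAt (fun q => Real.logb k (ρ / q)) ρs := by
    have hne : ρ / ρs ≠ 0 := (div_pos (hρs.trans h) hρs).ne'
    simp only [Real.logb]
    exact ((continuousAt_const.div continuousAt_id hρs.ne').log hne).div_const _
  have h1 : ∀ᶠ q in 𝓝[>] ρs, Real.logb k (ρ / ρs) - ε < Real.logb k (ρ / q) :=
    (hc.tendsto.mono_left nhdsWithin_le_nhds).eventually_const_lt (by linarith)
  obtain ⟨q, h2, h3⟩ := (h1.and (Ioo_mem_nhdsGT h)).exists
  exact ⟨q, h3.1, h3.2, h2.le⟩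

end RegularSeq

theorem mainTheorem6 :
    -- A Hölder distribution function bounds the lower local dimension from below.
    (∀ (μ : Measure UnitAddCircle) [IsProbabilityMeasure μ] (α : NNReal),
      (∃ C : NNReal, HolderWith C α (RegularSeq.distFun μ)) →
        ∀ x : UnitAddCircle, ((α : ℝ) : EReal) ≤ RegularSeq.lowerLocalDim μ x) ∧
    -- The measure of a positive regular sequence.
    (∀ (k : ℕ) (f : ℕ → ℤ) (d : ℕ), 2 ≤ k → RegularSeq.IsRegular k f →
      0 ≤ f 0 → (∀ m : ℕ, 1 ≤ m → 0 < f m) →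
      ∀ (b : Module.Basis (Fin d) ℚ (RegularSeq.kernelSpace k f))
        (B : Fin k → Matrix (Fin d) (Fin d) ℚ), RegularSeq.IsDigitMatrices b B →
      ∀ ρ ρs : ℝ,
        ρ = RegularSeq.specRadius (RegularSeq.toComplex (∑ a, B a)) →
        ρs = RegularSeq.jointSpecRadius (fun a => RegularSeq.toComplex (B a)) →
        RegularSeq.SpecRadiusUniqueDominant (RegularSeq.toComplex (∑ a, B a)) →
        ρs < ρ →
        ∃ μ : Measure UnitAddCircle,
          IsProbabilityMeasure μ ∧
          RegularSeq.ConvergesWeakly (RegularSeq.approxMeasure k f) μ ∧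
          (∀ x : UnitAddCircle, μ {x} = 0) ∧
          (∀ x : UnitAddCircle,
            ((Real.logb k (ρ / ρs) : ℝ) : EReal) ≤ RegularSeq.lowerLocalDim μ x) ∧
          (∀ ε : ℝ, 0 < ε → ∃ r₀ : ℝ, 0 < r₀ ∧ ∀ r : ℝ, 0 < r → r < r₀ →
            ∀ x : UnitAddCircle,
              ((Real.logb k (ρ / ρs) - ε : ℝ) : EReal) ≤ RegularSeq.localRatio μ x r)) := by
  refine ⟨fun μ _ α ⟨C, hC⟩ x => RegularSeq.le_lowerLocalDim_of_holderWith hC x, ?_⟩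
  intro k f d hk _ hf0 hf b B hB ρ ρs hρ hρs hdom hlt
  have hk1 : (1 : ℝ) < k := by exact_mod_cast hk
  have hk0 : (0 : ℝ) < k := one_pos.trans hk1
  -- Every number above `ρs` exceeds `1`. In particular `ρs > 0`, as continuity of `log_k (ρ / q)`
  -- at `q = ρs` requires.
  have hρs1 : 1 ≤ ρs := by
    rw [hρs]
    exact le_of_forall_gt_imp_ge_of_dense fun a ha =>
      (RegularSeq.one_lt_of_jointSpecRadius_lt hk hf hB ha).le
  have hρs0 : 0 < ρs := one_pos.trans_le hρs1
  obtain ⟨W, hW, hWC⟩ := RegularSeq.exists_tendsto_blockSum_div_regionSum hk hf0 hf hB hρ hdom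
    (hρs ▸ hlt)
  rw [← hρs] at hWC
  have hprob := RegularSeq.isProbabilityMeasure_approxMeasure hk hf
  have hcauchy := RegularSeq.cauchySeq_integral_approxMeasure hk hf fun ℓ M => ⟨_, hW ℓ M⟩
  obtain ⟨μ, hμ⟩ := RegularSeq.exists_tendsto_of_cauchySeq_integral
    (fun n => (⟨RegularSeq.approxMeasure k f n, hprob n⟩ : ProbabilityMeasure UnitAddCircle))
    hcauchy
  have hball : ∀ q, ρs < q → q < ρ → ∃ C, 0 < C ∧ ∀ x r, 0 < r → r < 1 →
      (μ : Measure UnitAddCircle) (Metric.ball x r) ≤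
        ENNReal.ofReal (C * r ^ Real.logb k (ρ / q)) := by
    intro q hq hqρ
    obtain ⟨C, hC, H⟩ := hWC q hq
    exact ⟨2 * k * (C + 1) * (k : ℝ) ^ Real.logb k (ρ / q), by positivity, fun x r hr hr1 =>
      RegularSeq.measure_ball_le_rpow hk hf (hρs0.trans hq) hqρ hC hW H (fun _ => rfl) hμ x hr hr1⟩
  have hunif : ∀ ε : ℝ, 0 < ε → ∃ r₀ : ℝ, 0 < r₀ ∧ ∀ r : ℝ, 0 < r → r < r₀ →
      ∀ x : UnitAddCircle, ((Real.logb k (ρ / ρs) - ε : ℝ) : EReal) ≤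
        RegularSeq.localRatio (μ : Measure UnitAddCircle) x r := by
    intro ε hε
    -- Half of `ε` pays for replacing `ρs` by `q`, the other half for the constant `C`.
    obtain ⟨q, hq, hqρ, hle⟩ := RegularSeq.exists_lt_logb_div k hρs0 hlt (half_pos hε)
    obtain ⟨C, hC, H⟩ := hball q hq hqρ
    obtain ⟨r₀, hr₀, H'⟩ := RegularSeq.exists_localRatio_ge hC one_pos H (half_pos hε)
    refine ⟨r₀, hr₀, fun r hr hrr x => le_trans ?_ (H' r hr hrr x)⟩
    exact_mod_cast (by linarith :
      Real.logb k (ρ / ρs) - ε ≤ Real.logb k (ρ / q) - ε / 2)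
  refine ⟨μ, inferInstance, fun g => ?_, fun x => ?_, RegularSeq.le_lowerLocalDim hunif, hunif⟩
  · exact ProbabilityMeasure.tendsto_iff_forall_integral_tendsto.1 hμ
      (BoundedContinuousFunction.mkOfCompact g)
  · obtain ⟨q, hq, hqρ⟩ := exists_between hlt
    obtain ⟨C, hC, H⟩ := hball q hq hqρ
    exact RegularSeq.measure_singleton_eq_zero_of_ball_le
      (Real.logb_pos hk1 ((one_lt_div (hρs0.trans hq)).2 hqρ)) (H x)
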